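/- Let $n\ge 1$, let $(M,g)$ be a smooth Riemannian manifold without boundary, and let $S^n\subset\mathbb{R}^{n+1}$ be the unit sphere with its round metric, Levi-Civita connection $\nabla$ and curvature tensor $R(X,Y)=\nabla_{[X,Y]}-[\nabla_X,\nabla_Y]$. For a smooth map $\phi:M\to S^n$ let $\nabla^\phi$ be the pull-back connection on $\phi^{-1}TS^n$; traces are taken with respect to $g$. The map $\phi$ is *harmonic* if $\operatorname{trace}\nabla d\phi=0$, and a *harmonic morphism* if for every open $U\subseteq S^n$ and every harmonic function $f$ on $U$ the function $f\circ\phi$ is harmonic on $\phi^{-1}(U)$. For a smooth section $V$ of $\phi^{-1}TS^n$ put $$J^\phi V=-\operatorname{trace}\nabla^2V-\operatorname{trace}R(d\phi,V)d\phi,\qquad \nabla^2_{X,Y}V=\nabla^\phi_X\nabla^\phi_YV-\nabla^\phi_{\nabla^M_XY}V,$$ $$K(\phi)=\{V:\ J^\phi V=0,\ \operatorname{trace}\langle d\phi,\nabla^\phi V\rangle=0\}.$$ The section $V$ is *projectable* if $\phi(x)=\phi(x')$ implies $V(x)=V(x')$, and a *harmonic variation* of $\phi$ if $\exp(tV):M\to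 S^n$, $x\mapsto\exp_{\phi(x)}(tV(x))$, is a harmonic map for every $t\in\mathbb{R}$. A harmonic map $\phi:M\to S^n$ is *infinitesimally rigid* if for every projectable $V\in K(\phi)$ there is $X\in so(n+1)$ (regarded as the vector field $p\mapsto Xp$ on $S^n$) with $V=X\circ\phi$; it is *locally rigid* if for every projectable harmonic variation $V$ there is a one-parameter subgroup $(g_t)_{t\in\mathbb{R}}$ of $O(n+1)$ with $\exp(tV)=g_t\circ\phi$ for all $t\in\mathbb{R}$. Let $\phi:M\to S^n$ be a surjective and submersive (smooth) harmonic morphism. Then: (i) $\phi$ is infinitesimally rigid. (ii) If $n$ is odd, then $\phi$ is locally rigid. -/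

import Mathlib

open scoped Manifold ContDiff
open Bundle

noncomputable section

namespace SphereRigidity

/-- Euclidean space `ℝ^k`. -/
abbrev Eucl (k : ℕ) : Type := EuclideanSpace ℝ (Fin k)

/-- The unit sphere `S^n` in `ℝ^{n+1}`, with its standard smooth structure. -/
abbrev Sph (n : ℕ) : Type := Metric.sphere (0 : Eucl (n + 1)) 1

/-- Smooth Riemannian metrics on an `m`-dimensional smooth manifold (without boundary). -/
abbrev SmoothMetric (m : ℕ) (M : Type*) [TopologicalSpace M] [ChartedSpace (Eucl m) M]
    [IsManifold (𝓡 m) ∞ M] :=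
  ContMDiffRiemannianMetric (𝓡 m) ∞ (Eucl m) (fun x : M => TangentSpace (𝓡 m) x)

/-! ### The round metric on the sphere -/

section RoundMetric

theorem finrank_fact (n : ℕ) : Fact (Module.finrank ℝ (Eucl (n + 1)) = n + 1) := ⟨by simp⟩

/-- The differential at `p` of the inclusion `S^n → ℝ^{n+1}`. -/
def inclDeriv (n : ℕ) (p : Sph n) : TangentSpace (𝓡 n) p →L[ℝ] Eucl (n + 1) :=
  mvfderiv (𝓡 n) (Subtype.val : Sph n → Eucl (n + 1)) p

/-- The inner product on `T_p S^n` induced by the inclusion in `ℝ^{n+1}`. -/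
def roundForm (n : ℕ) (p : Sph n) :
    TangentSpace (𝓡 n) p →L[ℝ] TangentSpace (𝓡 n) p →L[ℝ] ℝ :=
  let A : Eucl n →L[ℝ] Eucl (n + 1) := inclDeriv n p
  ((innerSL ℝ (E := Eucl (n + 1))).bilinearComp A A : Eucl n →L[ℝ] Eucl n →L[ℝ] ℝ)

theorem roundForm_apply (n : ℕ) (p : Sph n) (u v : TangentSpace (𝓡 n) p) :
    roundForm n p u v = inner ℝ (inclDeriv n p u) (inclDeriv n p v) := rfl

theorem roundForm_pos (n : ℕ) (p : Sph n) (u : TangentSpace (𝓡 n) p) (hu : u ≠ 0) :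
    0 < roundForm n p u u := by
  have := finrank_fact n
  rw [roundForm_apply]
  refine real_inner_self_pos.2 fun h => hu ?_
  exact injective_mvfderiv_subtypeVal_sphere p (h.trans (map_zero _).symm)

theorem isVonNBounded_of_pos {m : ℕ} (B : Eucl m →L[ℝ] Eucl m →L[ℝ] ℝ)
    (pos : ∀ a, a ≠ 0 → 0 < B a a) : Bornology.IsVonNBounded ℝ {v | B v v < 1} := by
  rw [NormedSpace.isVonNBounded_iff]
  have hc : Continuous fun v => B v v := by fun_prop
  rcases (Metric.sphere (0 : Eucl m) 1).eq_empty_or_nonempty with h | h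
  · refine Metric.isBounded_closedBall (x := (0 : Eucl m)) (r := 0) |>.subset fun v _ => ?_
    by_contra hv
    have hv : v ≠ 0 := by rintro rfl; simp at hv
    have : (‖v‖⁻¹ • v) ∈ Metric.sphere (0 : Eucl m) 1 := by
      simp [norm_smul, hv]
    simp [h] at this
  obtain ⟨w, hw, hmin⟩ := (isCompact_sphere (0 : Eucl m) 1).exists_isMinOn h hc.continuousOn
  have hw0 : w ≠ 0 := by rintro rfl; simp at hw
  have hp := pos w hw0
  refine Metric.isBounded_closedBall (x := (0 : Eucl m)) (r := √(1 / B w w)) |>.subset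
    fun v hv => ?_
  rw [mem_closedBall_zero_iff]
  apply Real.le_sqrt_of_sq_le
  rcases eq_or_ne v 0 with rfl | h0
  · simp; positivity
  have hn : 0 < ‖v‖ := norm_pos_iff.2 h0
  have : B w w ≤ B (‖v‖⁻¹ • v) (‖v‖⁻¹ • v) := hmin (by simp [norm_smul, h0])
  simp only [map_smul, smul_apply, smul_eq_mul] at this
  have hv : B v v < 1 := hv
  rw [le_div_iff₀ hp]
  calc ‖v‖ ^ 2 * B w w ≤ ‖v‖ ^ 2 * (‖v‖⁻¹ * (‖v‖⁻¹ * B v v)) := by gcongr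
    _ = B v v := by field_simp
    _ ≤ 1 := hv.le

theorem contDiff_pullbackInner (n : ℕ) :
    ContDiff ℝ ∞ (fun A : Eucl n →L[ℝ] Eucl (n + 1) =>
      (innerSL ℝ (E := Eucl (n + 1))).bilinearComp A A) := by
  have : (fun A : Eucl n →L[ℝ] Eucl (n + 1) =>
      (innerSL ℝ (E := Eucl (n + 1))).bilinearComp A A) =
      fun A => (ContinuousLinearMap.flipₗᵢ ℝ _ _ _ (((ContinuousLinearMap.flipₗᵢ ℝ _ _ _
        ((innerSL ℝ (E := Eucl (n + 1))).comp A))).comp A)) := by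
    ext A; rfl
  rw [this]
  exact (LinearIsometryEquiv.contDiff _).comp (ContDiff.clm_comp
    ((LinearIsometryEquiv.contDiff _).comp (contDiff_const.clm_comp contDiff_id)) contDiff_id)

/-- The round metric of `S^n`, induced by the inclusion in `ℝ^{n+1}`. -/
def roundMetric (n : ℕ) : SmoothMetric n (Sph n) where
  inner := roundForm n
  symm p u v := by rw [roundForm_apply, roundForm_apply, real_inner_comm]
  pos p u hu := roundForm_pos n p u hu
  isVonNBounded p := isVonNBounded_of_pos (roundForm n p) (roundForm_pos n p)
  contMDiff := by
    have := finrank_fact n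
    intro p
    rw [contMDiffAt_section]
    have h1 := (contMDiff_coe_sphere (E := Eucl (n + 1)) (n := n) (m := ∞) p).mfderiv_const
      (m := ∞) (by simp)
    have h2 := (contDiff_pullbackInner n).contMDiff.contMDiffAt.comp p h1
    refine h2.congr_of_eventuallyEq ?_
    have hp : p ∈ (trivializationAt (Eucl n) (TangentSpace (𝓡 n)) p).baseSet :=
      FiberBundle.mem_baseSet_trivializationAt' p
    filter_upwards [(trivializationAt (Eucl n) (TangentSpace (𝓡 n)) p).open_baseSet.mem_nhds hp]
      with q hq
    ext u v
    rw [hom_trivializationAt_apply]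
    have := inCoordinates_apply_eq₂ (F₃ := ℝ) (E₃ := Bundle.Trivial (Sph n) ℝ)
      (ϕ := roundForm n q) (v := u) (w := v) hq hq (Set.mem_univ q)
    refine this.trans ?_
    simp [inTangentCoordinates, ContinuousLinearMap.inCoordinates]
    rw [← Trivialization.symmL_apply (R := ℝ) _ hq, ← Trivialization.symmL_apply (R := ℝ) _ hq]
    rfl

end RoundMetric

/-! ### Riemannian geometry of the domain, in the preferred chart at a point

`TangentSpace (𝓡 m) x` is by definition the model space `ℝ^m`, a vector being identified with its
coordinates in the preferred chart at `x`.  All derivatives below are taken in that chart; constant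
vectors `u : ℝ^m` stand for the corresponding coordinate vector fields near `x`. -/

section Domain

theorem exists_orthonormal_aux {m : ℕ} {F : Type*} [AddCommGroup F] [Module ℝ F]
    [FiniteDimensional ℝ F] (hd : Module.finrank ℝ F = m) (B : F → F → ℝ)
    (hl : ∀ a b c, B (a + b) c = B a c + B b c) (hs : ∀ (r : ℝ) a b, B (r • a) b = r * B a b)
    (symm : ∀ a b, B a b = B b a) (pos : ∀ a, a ≠ 0 → 0 < B a a) :
    ∃ e : Fin m → F, ∀ i j, B (e i) (e j) = if i = j then 1 else 0 := by
  have h0 : ∀ b, B 0 b = 0 := fun b => by simpa using hs 0 0 b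
  let c : InnerProductSpace.Core ℝ F :=
    { inner := B
      conj_inner_symm := fun a b => by simpa using symm b a
      re_inner_nonneg := fun a => by
        rcases eq_or_ne a 0 with rfl | h
        · simp [h0]
        · simpa using (pos a h).le
      add_left := hl
      smul_left := fun a b r => by simpa using hs r a b
      definite := fun a h => by
        by_contra hne
        exact (pos a hne).ne' h }
  let _ : NormedAddCommGroup F := c.toNormedAddCommGroup
  let _ : InnerProductSpace ℝ F := InnerProductSpace.ofCore c.toCore
  let b := (stdOrthonormalBasis ℝ F).reindex (finCongr hd)
  exact ⟨b, fun i j => orthonormal_iff_ite.1 b.orthonormal i j⟩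

variable {m : ℕ} {M : Type*} [TopologicalSpace M] [ChartedSpace (Eucl m) M]
  [IsManifold (𝓡 m) ∞ M]

/-- A map on `M` read in the preferred chart at `x`. -/
def inChart {W : Type*} (x : M) (F : M → W) : Eucl m → W :=
  fun y => F ((extChartAt (𝓡 m) x).symm y)

/-- The coordinates of `x` in its preferred chart. -/
def center (x : M) : Eucl m := extChartAt (𝓡 m) x x

/-- The coordinate vector field with constant coordinates `u` in the chart at `x`, at the point
with coordinates `y`. -/
def coordField (x : M) (u y : Eucl m) : TangentSpace (𝓡 m) ((extChartAt (𝓡 m) x).symm y) :=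
  mfderiv 𝓘(ℝ, Eucl m) (𝓡 m) (extChartAt (𝓡 m) x).symm y u

/-- The metric coefficient `g(∂_u, ∂_v)` as a function of the coordinates. -/
def metricCoeff (g : SmoothMetric m M) (x : M) (u v y : Eucl m) : ℝ :=
  g.inner ((extChartAt (𝓡 m) x).symm y) (coordField x u y) (coordField x v y)

/-- The Christoffel symbol of the first kind at `x`,
`½ (∂_u g(∂_v, ∂_w) + ∂_v g(∂_u, ∂_w) - ∂_w g(∂_u, ∂_v))`. -/
def christoffelLower (g : SmoothMetric m M) (x : M) (u v w : Eucl m) : ℝ :=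
  (1 / 2) * (fderiv ℝ (metricCoeff g x v w) (center x) u
    + fderiv ℝ (metricCoeff g x u w) (center x) v
    - fderiv ℝ (metricCoeff g x u v) (center x) w)

theorem exists_orthonormalFrame (g : SmoothMetric m M) (x : M) :
    ∃ e : Fin m → Eucl m, ∀ i j, g.inner x (e i) (e j) = if i = j then 1 else 0 := by
  let B : Eucl m → Eucl m → ℝ := fun u v => g.inner x u v
  have hl : ∀ a b c, B (a + b) c = B a c + B b c := fun a b c =>
    congrArg (fun L : TangentSpace (𝓡 m) x →L[ℝ] ℝ => L c) (map_add (g.inner x) a b)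
  have hs : ∀ (r : ℝ) a b, B (r • a) b = r * B a b := fun r a b =>
    congrArg (fun L : TangentSpace (𝓡 m) x →L[ℝ] ℝ => L b) (map_smul (g.inner x) r a)
  have hsymm : ∀ a b, B a b = B b a := fun a b => g.symm x a b
  have hpos : ∀ a, a ≠ 0 → 0 < B a a := fun a ha => g.pos x a ha
  exact exists_orthonormal_aux (finrank_euclideanSpace_fin (𝕜 := ℝ)) B hl hs hsymm hpos

/-- A `g`-orthonormal basis `(e_i)` of `T_x M`. -/
def frame (g : SmoothMetric m M) (x : M) : Fin m → Eucl m :=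
  (exists_orthonormalFrame g x).choose

/-- The Levi-Civita derivative `∇_u ∂_v` at `x` of coordinate fields: the vector `Γ(u, v)` with
`g(Γ(u, v), w) = christoffelLower g x u v w` for all `w`. -/
def christoffel (g : SmoothMetric m M) (x : M) (u v : Eucl m) : Eucl m :=
  ∑ i, christoffelLower g x u v (frame g x i) • frame g x i

/-- The Laplacian `trace ∇df` of a function at `x`. -/
def laplacian (g : SmoothMetric m M) (f : M → ℝ) (x : M) : ℝ :=
  ∑ i, (fderiv ℝ (fun y => fderiv ℝ (inChart x f) y (frame g x i)) (center x) (frame g x i)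
    - fderiv ℝ (inChart x f) (center x) (christoffel g x (frame g x i) (frame g x i)))

/-- `f` is a (smooth) harmonic function on the open set `U`. -/
def IsHarmonicFunctionOn (g : SmoothMetric m M) (f : M → ℝ) (U : Set M) : Prop :=
  ContMDiffOn (𝓡 m) 𝓘(ℝ, ℝ) ∞ f U ∧ ∀ x ∈ U, laplacian g f x = 0

end Domain

/-- A smooth map between Riemannian manifolds is a harmonic morphism if it pulls back harmonic
functions on open subsets to harmonic functions. -/
def IsHarmonicMorphism {m n : ℕ} {M N : Type*}
    [TopologicalSpace M] [ChartedSpace (Eucl m) M] [IsManifold (𝓡 m) ∞ M]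
    [TopologicalSpace N] [ChartedSpace (Eucl n) N] [IsManifold (𝓡 n) ∞ N]
    (g : SmoothMetric m M) (h : SmoothMetric n N) (φ : M → N) : Prop :=
  ContMDiff (𝓡 m) (𝓡 n) ∞ φ ∧
    ∀ (U : Set N) (f : N → ℝ), IsOpen U → IsHarmonicFunctionOn h f U →
      IsHarmonicFunctionOn g (f ∘ φ) (φ ⁻¹' U)

/-! ### Geometry of the sphere as a submanifold of Euclidean space

The tangent space `T_p S^n` is the orthogonal complement of `p` in `ℝ^{n+1}`, and the Levi-Civita
connection of the round metric is the tangential part of the Euclidean derivative. -/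

section Target

variable {n : ℕ}

/-- The orthogonal projection of `ℝ^{n+1}` onto `T_p S^n`, for `p` a unit vector. -/
def tangentPart (p w : Eucl (n + 1)) : Eucl (n + 1) := w - (inner ℝ p w : ℝ) • p

/-- The Levi-Civita derivative `∇_X Y` on `S^n`, for vector fields tangent to `S^n` that are
given as fields on `ℝ^{n+1}`. -/
def sphereNabla (X Y : Eucl (n + 1) → Eucl (n + 1)) : Eucl (n + 1) → Eucl (n + 1) :=
  fun q => tangentPart q (fderiv ℝ Y q (X q))

/-- An extension of a tangent vector to a field that is tangent to `S^n`. -/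
def tangentExtension (w : Eucl (n + 1)) : Eucl (n + 1) → Eucl (n + 1) :=
  fun q => tangentPart q w

/-- The curvature tensor of `S^n` at `p` on tangent vectors, in Milnor's sign convention
`R(X, Y) Z = ∇_{[X, Y]} Z - ∇_X ∇_Y Z + ∇_Y ∇_X Z`. -/
def sphereCurvature (p : Sph n) (a b c : Eucl (n + 1)) : Eucl (n + 1) :=
  let X := tangentExtension a
  let Y := tangentExtension b
  let Z := tangentExtension c
  sphereNabla (VectorField.lieBracket ℝ X Y) Z p - sphereNabla X (sphereNabla Y Z) p
    + sphereNabla Y (sphereNabla X Z) p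

/-- `γ` is a geodesic of `S^n` defined on all of `ℝ`: the tangential part of its acceleration
vanishes. -/
def IsGeodesic (γ : ℝ → Sph n) : Prop :=
  ContDiff ℝ ∞ (fun t => (γ t : Eucl (n + 1))) ∧
    ∀ t, tangentPart (γ t : Eucl (n + 1))
      (deriv (deriv (fun s => (γ s : Eucl (n + 1)))) t) = 0

open Classical in
/-- The exponential map of `S^n`: `exp_p v = γ(1)` for the geodesic `γ` with `γ(0) = p` and
`γ'(0) = v` (and, by convention, `p` if `v` is not tangent at `p`). -/
def sphereExp (p : Sph n) (v : Eucl (n + 1)) : Sph n :=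
  if h : ∃ γ : ℝ → Sph n, IsGeodesic γ ∧ γ 0 = p ∧
      deriv (fun t => (γ t : Eucl (n + 1))) 0 = v
  then h.choose 1 else p

end Target

/-! ### Maps into the sphere and vector fields along them -/

section Maps

variable {m n : ℕ} {M : Type*} [TopologicalSpace M] [ChartedSpace (Eucl m) M]
  [IsManifold (𝓡 m) ∞ M]

/-- `dφ(∂_v)` in the chart at `x`, at the point with coordinates `y`. -/
def mapDeriv (φ : M → Sph n) (x : M) (v y : Eucl m) : Eucl (n + 1) :=
  fderiv ℝ (inChart x fun z => (φ z : Eucl (n + 1))) y v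

/-- The second fundamental form `(∇dφ)(u, v) = ∇^φ_u (dφ(∂_v)) - dφ(∇_u ∂_v)` at `x`. -/
def secondForm (g : SmoothMetric m M) (φ : M → Sph n) (x : M) (u v : Eucl m) : Eucl (n + 1) :=
  tangentPart (φ x : Eucl (n + 1)) (fderiv ℝ (mapDeriv φ x v) (center x) u)
    - mapDeriv φ x (christoffel g x u v) (center x)

/-- The tension field `τ_φ = trace ∇dφ`. -/
def tension (g : SmoothMetric m M) (φ : M → Sph n) (x : M) : Eucl (n + 1) :=
  ∑ i, secondForm g φ x (frame g x i) (frame g x i)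

/-- A harmonic map is a smooth map with vanishing tension field. -/
def IsHarmonicMap (g : SmoothMetric m M) (φ : M → Sph n) : Prop :=
  ContMDiff (𝓡 m) (𝓡 n) ∞ φ ∧ ∀ x, tension g φ x = 0

/-- `V` is a (smooth) vector field along `φ`, that is, a section of `φ⁻¹ T S^n`. -/
def IsVectorFieldAlong (m : ℕ) {n : ℕ} {M : Type*} [TopologicalSpace M]
    [ChartedSpace (Eucl m) M] (φ : M → Sph n) (V : M → Eucl (n + 1)) : Prop :=
  ContMDiff (𝓡 m) 𝓘(ℝ, Eucl (n + 1)) ∞ V ∧ ∀ x, inner ℝ (φ x : Eucl (n + 1)) (V x) = 0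

/-- The pull-back connection: `∇^φ_{∂_v} V` in the chart at `x`, at the point with
coordinates `y`. -/
def pullbackNabla (φ : M → Sph n) (V : M → Eucl (n + 1)) (x : M) (v y : Eucl m) :
    Eucl (n + 1) :=
  tangentPart (inChart x (fun z => (φ z : Eucl (n + 1))) y) (fderiv ℝ (inChart x V) y v)

/-- The second covariant derivative
`∇²_{u, v} V = ∇^φ_u (∇^φ_{∂_v} V) - ∇^φ_{∇_u ∂_v} V` at `x`. -/
def secondNabla (g : SmoothMetric m M) (φ : M → Sph n) (V : M → Eucl (n + 1)) (x : M)
    (u v : Eucl m) : Eucl (n + 1) :=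
  tangentPart (φ x : Eucl (n + 1)) (fderiv ℝ (pullbackNabla φ V x v) (center x) u)
    - pullbackNabla φ V x (christoffel g x u v) (center x)

/-- The Jacobi operator `J^φ V = - trace ∇² V - trace R(dφ, V) dφ`. -/
def jacobi (g : SmoothMetric m M) (φ : M → Sph n) (V : M → Eucl (n + 1)) (x : M) :
    Eucl (n + 1) :=
  - ∑ i, secondNabla g φ V x (frame g x i) (frame g x i)
    - ∑ i, sphereCurvature (φ x) (mapDeriv φ x (frame g x i) (center x)) (V x)
        (mapDeriv φ x (frame g x i) (center x))

/-- `V` is a Jacobi field along `φ`. -/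
def IsJacobiField (g : SmoothMetric m M) (φ : M → Sph n) (V : M → Eucl (n + 1)) : Prop :=
  IsVectorFieldAlong m φ V ∧ ∀ x, jacobi g φ V x = 0

/-- `V ∈ K(φ)`: `V` is a Jacobi field along `φ` with `trace ⟨dφ, ∇^φ V⟩ = 0`. -/
def MemK (g : SmoothMetric m M) (φ : M → Sph n) (V : M → Eucl (n + 1)) : Prop :=
  IsJacobiField g φ V ∧
    ∀ x, ∑ i, inner ℝ (mapDeriv φ x (frame g x i) (center x))
      (pullbackNabla φ V x (frame g x i) (center x)) = 0

/-- The deformation `φ_t = exp(tV)` of `φ`. -/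
def expVariation (φ : M → Sph n) (V : M → Eucl (n + 1)) (t : ℝ) : M → Sph n :=
  fun x => sphereExp (φ x) (t • V x)

/-- `V` is a harmonic variation of `φ`: `exp(tV)` is a harmonic map for all real `t`. -/
def IsHarmonicVariation (g : SmoothMetric m M) (φ : M → Sph n) (V : M → Eucl (n + 1)) : Prop :=
  IsVectorFieldAlong m φ V ∧ ∀ t : ℝ, IsHarmonicMap g (expVariation φ V t)

/-- `V` is projectable: it is constant on the fibres of `φ`. -/
def IsProjectable (φ : M → Sph n) (V : M → Eucl (n + 1)) : Prop :=
  ∀ x x', φ x = φ x' → V x = V x'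

/-- `φ` is an infinitesimally rigid harmonic map: every projectable `V ∈ K(φ)` is `X ∘ φ` for
some `X ∈ so(n+1)`, acting on `S^n` as the vector field `p ↦ X p`. -/
def IsInfinitesimallyRigid (g : SmoothMetric m M) (φ : M → Sph n) : Prop :=
  IsHarmonicMap g φ ∧
    ∀ V : M → Eucl (n + 1), IsProjectable φ V → MemK g φ V →
      ∃ X ∈ LieAlgebra.Orthogonal.so (Fin (n + 1)) ℝ,
        ∀ x, V x = Matrix.toEuclideanLin X (φ x : Eucl (n + 1))

/-- `φ` is a locally rigid harmonic map: for every projectable harmonic variation `V` there is a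
one-parameter subgroup `(g_t)` of `O(n+1)` with `exp(tV) = g_t ∘ φ` for all real `t`. -/
def IsLocallyRigid (g : SmoothMetric m M) (φ : M → Sph n) : Prop :=
  IsHarmonicMap g φ ∧
    ∀ V : M → Eucl (n + 1), IsProjectable φ V → IsHarmonicVariation g φ V →
      ∃ G : Multiplicative ℝ →ₜ* Matrix.orthogonalGroup (Fin (n + 1)) ℝ,
        ∀ (t : ℝ) (x : M), (expVariation φ V t x : Eucl (n + 1)) =
          Matrix.toEuclideanLin
            (G (Multiplicative.ofAdd t) : Matrix (Fin (n + 1)) (Fin (n + 1)) ℝ)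
            (φ x : Eucl (n + 1))

end Maps

end SphereRigidity

end

open SphereRigidity

/-! The sphere is treated extrinsically: maps and fields along them are vector-valued, and `mapLap`
is the componentwise Laplacian, written Δ below. The angle functions arctan(⟨v,·⟩/⟨u,·⟩), with u ⟂ v
of equal length, are harmonic on open half-spheres. Pulling them back shows that φ is harmonic and
that Σ ⟨a,dφ eᵢ⟩⟨b,dφ eᵢ⟩ is l times the inner product of the tangential parts of a and b, with l >
0 (`IsHarmonicMorphism.isHarmonicMap`, `IsHarmonicMorphism.exists_isDilation`). Consequently Δφ = -n
l φ, and Δ(h ∘ φ) is l times the spherical Laplacian of h (`IsHarmonicMap.mapLap_comp`).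

A projectable field therefore becomes a homogeneous function on punctured Euclidean space, smooth by
`exists_descent`. Compactness of the sphere enters through one integral: a subharmonic function
homogeneous of degree zero is constant, and so a harmonic function homogeneous of degree one is
linear, its derivatives being constant.

For V in K(φ), the Jacobi equation and the trace condition together say ΔV = -n l V. The degree-one
extension of V is then harmonic, hence linear, V = X ∘ φ, and X is skew because V ⟂ φ
(`exists_so_of_mapLap_eq`). This is (i).

For a harmonic variation, the time t = π/|V(x)| sends x to the antipode of φ(x), and the harmonic
map equation there gives Δ|V| = 0 at x (`IsHarmonicVariation.diffOp_norm`). So |V|² is subharmonic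
and |V| is a constant c. Now exp(tV) = cos(tc) φ + c⁻¹ sin(tc) V, and two values of t yield the same
equation ΔV = -n l V. Hence V = X ∘ φ with X² = -c², and exp(tV) = exp(tX) ∘ φ. This is (ii). -/

noncomputable section

set_option linter.unusedSectionVars false

namespace SphereRigidity

/-! ### Second-order operators without zeroth-order term -/

section SecondOrder

open Filter Topology

variable {E F G H : Type*} [NormedAddCommGroup E] [NormedSpace ℝ E]
  [NormedAddCommGroup F] [NormedSpace ℝ F] [NormedAddCommGroup G] [NormedSpace ℝ G]
  [NormedAddCommGroup H] [NormedSpace ℝ H] {ι : Type*} [Fintype ι]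

/-- The second derivative `∂_u ∂_v f` at `x`. -/
def deriv₂ (f : E → F) (x u v : E) : F := fderiv ℝ (fun y => fderiv ℝ f y v) x u

/-- The operator `∑ i, ∂_{e i} ∂_{e i} - ∂_c`. -/
def diffOp (e : ι → E) (c : E) (f : E → F) (x : E) : F :=
  ∑ i, deriv₂ f x (e i) (e i) - fderiv ℝ f x c

theorem eventually_differentiableAt {f : E → F} {x : E} (hf : ContDiffAt ℝ 2 f x) :
    ∀ᶠ y in 𝓝 x, DifferentiableAt ℝ f y :=
  (hf.eventually (by simp)).mono fun _ h => h.differentiableAt (by simp)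

theorem differentiableAt_fderiv {f : E → F} {x : E} (hf : ContDiffAt ℝ 2 f x) :
    DifferentiableAt ℝ (fderiv ℝ f) x :=
  (hf.fderiv_right (m := 1) (by norm_num)).differentiableAt (by simp)

theorem deriv₂_eq {f : E → F} {x : E} (hf : ContDiffAt ℝ 2 f x) (u v : E) :
    deriv₂ f x u v = fderiv ℝ (fderiv ℝ f) x u v := by
  rw [deriv₂, fderiv_clm_apply (differentiableAt_fderiv hf) (differentiableAt_const v)]
  simp

theorem deriv₂_symm {f : E → F} {x : E} (hf : ContDiffAt ℝ 2 f x) (u v : E) :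
    deriv₂ f x u v = deriv₂ f x v u := by
  rw [deriv₂_eq hf, deriv₂_eq hf]
  exact (hf.isSymmSndFDerivAt (by simp)) u v

theorem deriv₂_bilin (B : F →L[ℝ] G →L[ℝ] H) {f : E → F} {g : E → G} {x : E}
    (hf : ContDiffAt ℝ 2 f x) (hg : ContDiffAt ℝ 2 g x) (u v : E) :
    deriv₂ (fun y => B (f y) (g y)) x u v =
      B (deriv₂ f x u v) (g x) + B (fderiv ℝ f x v) (fderiv ℝ g x u)
        + B (fderiv ℝ f x u) (fderiv ℝ g x v) + B (f x) (deriv₂ g x u v) := by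
  have h1 : (fun y => fderiv ℝ (fun y => B (f y) (g y)) y v) =ᶠ[𝓝 x]
      fun y => B (f y) (fderiv ℝ g y v) + B (fderiv ℝ f y v) (g y) := by
    filter_upwards [eventually_differentiableAt hf, eventually_differentiableAt hg] with y h h'
    rw [B.fderiv_of_bilinear h h']
    simp
  have df := hf.differentiableAt (by simp)
  have dg := hg.differentiableAt (by simp)
  have df' : DifferentiableAt ℝ (fun y => fderiv ℝ f y v) x :=
    (differentiableAt_fderiv hf).clm_apply (differentiableAt_const v)
  have dg' : DifferentiableAt ℝ (fun y => fderiv ℝ g y v) x :=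
    (differentiableAt_fderiv hg).clm_apply (differentiableAt_const v)
  have e1 := B.hasFDerivAt_of_bilinear df.hasFDerivAt dg'.hasFDerivAt
  have e2 := B.hasFDerivAt_of_bilinear df'.hasFDerivAt dg.hasFDerivAt
  rw [deriv₂, h1.fderiv_eq, (e1.fun_add e2).fderiv]
  simp [deriv₂]
  abel

/-- The single Leibniz rule behind `diffOp_smul` and `diffOp_inner`. The two mixed terms coincide
because both differentiations are along the same e i. -/
theorem diffOp_bilin (B : F →L[ℝ] G →L[ℝ] H) {f : E → F} {g : E → G} {x : E}
    (hf : ContDiffAt ℝ 2 f x) (hg : ContDiffAt ℝ 2 g x) (e : ι → E) (c : E) :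
    diffOp e c (fun y => B (f y) (g y)) x =
      B (diffOp e c f x) (g x)
        + (2 : ℝ) • ∑ i, B (fderiv ℝ f x (e i)) (fderiv ℝ g x (e i))
        + B (f x) (diffOp e c g x) := by
  have h := B.fderiv_of_bilinear (hf.differentiableAt (by simp)) (hg.differentiableAt (by simp))
  simp only [diffOp, deriv₂_bilin B hf hg, Finset.sum_add_distrib, h, map_sub, map_sum]
  simp only [add_apply, ContinuousLinearMap.precompR_apply, ContinuousLinearMap.compL_apply,
    ContinuousLinearMap.comp_apply, ContinuousLinearMap.precompL_apply, sub_apply,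
    sum_apply, two_smul]
  abel

theorem deriv₂_comp {h : F → G} {f : E → F} {x : E}
    (hh : ContDiffAt ℝ 2 h (f x)) (hf : ContDiffAt ℝ 2 f x) (u v : E) :
    deriv₂ (fun y => h (f y)) x u v =
      deriv₂ h (f x) (fderiv ℝ f x u) (fderiv ℝ f x v) + fderiv ℝ h (f x) (deriv₂ f x u v) := by
  have h1 : (fun y => fderiv ℝ (fun y => h (f y)) y v) =ᶠ[𝓝 x]
      fun y => fderiv ℝ h (f y) (fderiv ℝ f y v) := by
    filter_upwards [eventually_differentiableAt hf,
      hf.continuousAt.eventually (eventually_differentiableAt hh)] with y h1 h2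
    rw [fderiv_fun_comp y h2 h1]
    simp
  have df := hf.differentiableAt (by simp)
  have df' : DifferentiableAt ℝ (fun y => fderiv ℝ f y v) x :=
    (differentiableAt_fderiv hf).clm_apply (differentiableAt_const v)
  have dh' : DifferentiableAt ℝ (fun y => fderiv ℝ h (f y)) x :=
    (differentiableAt_fderiv hh).comp x df
  rw [deriv₂_eq hh, deriv₂, h1.fderiv_eq, fderiv_clm_apply dh' df',
    fderiv_fun_comp x (differentiableAt_fderiv hh) df]
  simp [deriv₂]
  abel

theorem diffOp_comp {h : F → G} {f : E → F} {x : E}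
    (hh : ContDiffAt ℝ 2 h (f x)) (hf : ContDiffAt ℝ 2 f x) (e : ι → E) (c : E) :
    diffOp e c (fun y => h (f y)) x =
      ∑ i, deriv₂ h (f x) (fderiv ℝ f x (e i)) (fderiv ℝ f x (e i))
        + fderiv ℝ h (f x) (diffOp e c f x) := by
  simp only [diffOp, deriv₂_comp hh hf, Finset.sum_add_distrib, map_sub, map_sum,
    fderiv_fun_comp x (hh.differentiableAt (by simp)) (hf.differentiableAt (by simp))]
  simp [add_sub_assoc]

theorem deriv₂_clm (A : F →L[ℝ] G) (x u v : F) : deriv₂ A x u v = 0 := by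
  simp [deriv₂]

theorem diffOp_clm_comp (A : F →L[ℝ] G) {f : E → F} {x : E} (hf : ContDiffAt ℝ 2 f x)
    (e : ι → E) (c : E) : diffOp e c (fun y => A (f y)) x = A (diffOp e c f x) := by
  rw [diffOp_comp A.contDiff.contDiffAt hf]
  simp [deriv₂_clm]

/-- The sum is the linear map fst + snd applied to the pair (f, g), so the rule for linear maps
applies. -/
theorem diffOp_add {f g : E → F} {x : E} (hf : ContDiffAt ℝ 2 f x) (hg : ContDiffAt ℝ 2 g x)
    (e : ι → E) (c : E) :
    diffOp e c (fun y => f y + g y) x = diffOp e c f x + diffOp e c g x := by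
  have h := diffOp_clm_comp (ContinuousLinearMap.fst ℝ F F + ContinuousLinearMap.snd ℝ F F)
    (hf.prodMk hg) e c
  have h1 := diffOp_clm_comp (ContinuousLinearMap.fst ℝ F F) (hf.prodMk hg) e c
  have h2 := diffOp_clm_comp (ContinuousLinearMap.snd ℝ F F) (hf.prodMk hg) e c
  simp only [add_apply, ContinuousLinearMap.coe_fst',
    ContinuousLinearMap.coe_snd'] at h h1 h2
  rw [h, h1, h2]

theorem diffOp_smul {f : E → ℝ} {g : E → F} {x : E} (hf : ContDiffAt ℝ 2 f x)
    (hg : ContDiffAt ℝ 2 g x) (e : ι → E) (c : E) :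
    diffOp e c (fun y => f y • g y) x = diffOp e c f x • g x
      + (2 : ℝ) • ∑ i, fderiv ℝ f x (e i) • fderiv ℝ g x (e i) + f x • diffOp e c g x :=
  diffOp_bilin (ContinuousLinearMap.lsmul ℝ ℝ) hf hg e c

theorem diffOp_const_smul (r : ℝ) {g : E → F} {x : E}
    (hg : ContDiffAt ℝ 2 g x) (e : ι → E) (c : E) :
    diffOp e c (fun y => r • g y) x = r • diffOp e c g x :=
  diffOp_clm_comp (r • ContinuousLinearMap.id ℝ F) hg e c

theorem diffOp_inner {V : Type*} [NormedAddCommGroup V] [InnerProductSpace ℝ V]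
    {f g : E → V} {x : E} (hf : ContDiffAt ℝ 2 f x)
    (hg : ContDiffAt ℝ 2 g x) (e : ι → E) (c : E) :
    diffOp e c (fun y => inner ℝ (f y) (g y)) x = inner ℝ (diffOp e c f x) (g x)
      + 2 * ∑ i, inner ℝ (fderiv ℝ f x (e i)) (fderiv ℝ g x (e i))
      + inner ℝ (f x) (diffOp e c g x) :=
  diffOp_bilin (innerSL ℝ (E := V)) hf hg e c

theorem diffOp_const (a : F) (e : ι → E) (c x : E) : diffOp e c (fun _ => a) x = 0 := by
  simp [diffOp, deriv₂]

/-- The chain rule for functions of one real variable. -/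
theorem diffOp_comp_real {h : ℝ → ℝ} {f : E → ℝ} {x : E}
    (hh : ContDiffAt ℝ 2 h (f x)) (hf : ContDiffAt ℝ 2 f x) (e : ι → E) (c : E) :
    diffOp e c (fun y => h (f y)) x =
      deriv (deriv h) (f x) * ∑ i, fderiv ℝ f x (e i) ^ 2
        + deriv h (f x) * diffOp e c f x := by
  have h2 : ∀ a : ℝ, deriv₂ h (f x) a a = deriv (deriv h) (f x) * a ^ 2 := fun a => by
    have h1 : (fun y => fderiv ℝ h y a) = fun y => a * deriv h y := by
      ext y
      rw [← smul_eq_mul, ← fderiv_eq_smul_deriv]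
    have hd : DifferentiableAt ℝ (deriv h) (f x) := by
      have := (differentiableAt_fderiv hh).clm_apply (differentiableAt_const (1 : ℝ))
      simpa using this
    rw [deriv₂, h1, fderiv_eq_smul_deriv, deriv_const_mul _ hd, smul_eq_mul]
    ring
  rw [diffOp_comp hh hf, fderiv_eq_smul_deriv, smul_eq_mul, mul_comm (diffOp e c f x)]
  simp only [h2, Finset.mul_sum]

end SecondOrder

/-! ### Homogeneous functions on punctured Euclidean space -/

section Homogeneous

open Filter Topology MeasureTheory

variable {E F : Type*} [NormedAddCommGroup E] [NormedSpace ℝ E]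
  [NormedAddCommGroup F] [NormedSpace ℝ F]

/-- `f` is positively homogeneous of degree `k` away from the origin. -/
def IsHomogeneous (k : ℤ) (f : E → F) : Prop :=
  ∀ x : E, x ≠ 0 → ∀ r : ℝ, 0 < r → f (r • x) = r ^ k • f x

/-- `f` is smooth away from the origin. -/
def IsSmoothOffZero (f : E → F) : Prop := ∀ x : E, x ≠ 0 → ContDiffAt ℝ ∞ f x

theorem IsSmoothOffZero.two {f : E → F} (hf : IsSmoothOffZero f) {x : E} (hx : x ≠ 0) :
    ContDiffAt ℝ 2 f x :=
  (hf x hx).of_le (WithTop.coe_le_coe.2 le_top)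

theorem IsSmoothOffZero.fderiv_apply {f : E → F} (hf : IsSmoothOffZero f) (v : E) :
    IsSmoothOffZero fun y => fderiv ℝ f y v := fun x hx =>
  ((hf x hx).fderiv_right (m := ∞) (by simp)).clm_apply contDiffAt_const

/-- Euler's identity: differentiate f(r x) = rᵏ f(x) in r at r = 1. -/
theorem IsHomogeneous.fderiv_self {k : ℤ} {f : E → F} (hk : IsHomogeneous k f) {x : E}
    (hx : x ≠ 0) (hf : DifferentiableAt ℝ f x) : fderiv ℝ f x x = (k : ℝ) • f x := by
  have h1 : HasDerivAt (fun r : ℝ => r • x) x 1 := by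
    simpa using (hasDerivAt_id (1 : ℝ)).smul_const x
  have h2 : HasDerivAt (fun r : ℝ => f (r • x)) (fderiv ℝ f x x) 1 :=
    HasFDerivAt.comp_hasDerivAt (f := fun r : ℝ => r • x) 1
      (by simpa using hf.hasFDerivAt) h1
  have h3 : HasDerivAt (fun r : ℝ => r ^ k • f x) ((k : ℝ) • f x) 1 := by
    simpa using (hasDerivAt_zpow k (1 : ℝ) (by simp)).smul_const (f x)
  refine h2.unique (h3.congr_of_eventuallyEq ?_)
  filter_upwards [lt_mem_nhds (zero_lt_one (α := ℝ))] with r hr using hk x hx r hr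

/-- Differentiating f(r y) = rᵏ f(y) in y costs one factor r on the left, which is divided out. -/
theorem IsHomogeneous.fderiv_apply {k : ℤ} {f : E → F} (hk : IsHomogeneous k f) (v : E) :
    IsHomogeneous (k - 1) fun y => fderiv ℝ f y v := by
  intro x hx r hr
  have h : (fun y => f (r • y)) =ᶠ[𝓝 x] fun y => r ^ k • f y := by
    filter_upwards [isOpen_ne.mem_nhds hx] with y hy using hk y hy r hr
  have h1 := h.fderiv_eq (𝕜 := ℝ)
  have h2 : fderiv ℝ (fun y => f (r • y)) x = r • fderiv ℝ f (r • x) :=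
    fderiv_comp_smul (𝕜 := ℝ) (f := f) (c := r) (x := x)
  have h3 : fderiv ℝ (fun y => r ^ k • f y) x = r ^ k • fderiv ℝ f x :=
    congrFun (fderiv_const_smul_field (r ^ k) (f := f) (𝕜 := ℝ)) x
  rw [h2, h3] at h1
  have h4 := congrArg (fun A : E →L[ℝ] F => r⁻¹ • A v) h1
  simp only [smul_apply, smul_smul, inv_mul_cancel₀ hr.ne', one_smul] at h4
  simp only [h4, zpow_sub_one₀ hr.ne', mul_comm]

theorem IsHomogeneous.deriv₂_self {k : ℤ} {f : E → F} (hk : IsHomogeneous k f)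
    (hf : IsSmoothOffZero f) {x : E} (hx : x ≠ 0) (v : E) :
    deriv₂ f x x v = ((k : ℝ) - 1) • fderiv ℝ f x v := by
  have := (hk.fderiv_apply v).fderiv_self hx
    ((hf.fderiv_apply v x hx).differentiableAt (by simp))
  simpa [deriv₂] using this

variable {N : ℕ}

/-- The Laplacian of `ℝ^N`. -/
def lap (f : Eucl N → F) (x : Eucl N) : F :=
  diffOp (fun i : Fin N => EuclideanSpace.single i (1 : ℝ)) 0 f x

theorem lap_eq (f : Eucl N → F) (x : Eucl N) :
    lap f x = ∑ i : Fin N, deriv₂ f x (EuclideanSpace.single i 1) (EuclideanSpace.single i 1) := by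
  simp [lap, diffOp]

theorem sum_smul_single (x : Eucl N) :
    ∑ i : Fin N, x i • EuclideanSpace.single i (1 : ℝ) = x := by
  have := (EuclideanSpace.basisFun (Fin N) ℝ).sum_repr x
  simpa using this

/-- The integral of the Laplacian of a function homogeneous of degree zero vanishes over every
radially weighted shell. -/
theorem integral_mul_lap_eq_zero {u : Eucl N → ℝ} (hu : IsSmoothOffZero u)
    (h0 : IsHomogeneous 0 u) {R : ℝ} (η : ContDiffBump R) (hη : η.rOut < R) :
    (Continuous fun x => η (‖x‖ ^ 2) * lap u x) ∧
      HasCompactSupport (fun x => η (‖x‖ ^ 2) * lap u x) ∧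
      ∫ x : Eucl N, η (‖x‖ ^ 2) * lap u x = 0 := by
  have hR : 0 < R := η.rOut_pos.trans hη
  -- η is a bump around R in the variable ‖x‖², so `hη` makes χ vanish near the origin, the only
  -- point where u may fail to be smooth.
  let χ : Eucl N → ℝ := fun x => η (‖x‖ ^ 2)
  have hχ : ContDiff ℝ ∞ χ := η.contDiff.comp (contDiff_norm_sq ℝ)
  have hχ0 : ∀ᶠ y in 𝓝 (0 : Eucl N), χ y = 0 := by
    have : ∀ᶠ y in 𝓝 (0 : Eucl N), ‖y‖ ^ 2 < R - η.rOut := by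
      have hc : Continuous fun y : Eucl N => ‖y‖ ^ 2 := by fun_prop
      exact hc.continuousAt.eventually_lt_const (by simpa using hη)
    filter_upwards [this] with y hy
    apply η.zero_of_le_dist
    rw [dist_comm, Real.dist_eq]
    exact le_trans (by linarith) (le_abs_self _)
  have hχs : ∀ y, y ∉ Metric.closedBall (0 : Eucl N) (√(2 * R)) → χ y = 0 := by
    intro y hy
    rw [mem_closedBall_zero_iff, not_le] at hy
    have := (Real.sqrt_lt' ((Real.sqrt_nonneg _).trans_lt hy)).1 hy
    apply η.zero_of_le_dist
    rw [Real.dist_eq]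
    exact le_trans (by linarith) (le_abs_self _)
  let b : Fin N → Eucl N := fun i => EuclideanSpace.single i (1 : ℝ)
  let G : Fin N → Eucl N → ℝ := fun i x => χ x * fderiv ℝ u x (b i)
  have hG : ∀ i, ContDiff ℝ 1 (G i) := fun i => contDiff_iff_contDiffAt.2 fun x => by
    by_cases hx : x = 0
    · subst hx
      refine (contDiffAt_const (c := (0 : ℝ))).congr_of_eventuallyEq ?_
      filter_upwards [hχ0] with y hy
      simp [G, hy]
    · exact (hχ.contDiffAt.mul (hu.fderiv_apply (b i) x hx)).of_le (by exact_mod_cast le_top)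
  have hGs : ∀ i, HasCompactSupport (G i) := fun i =>
    HasCompactSupport.of_support_subset_isCompact (isCompact_closedBall 0 (√(2 * R))) fun y hy => by
      by_contra h
      exact hy (by simp [G, hχs y h])
  have hGd : ∀ i, Continuous fun x => fderiv ℝ (G i) x (b i) := fun i =>
    ((hG i).continuous_fderiv (by simp)).clm_apply continuous_const
  have hGds : ∀ i, HasCompactSupport fun x => fderiv ℝ (G i) x (b i) := fun i =>
    (hGs i).fderiv_apply (𝕜 := ℝ) (b i)
  have hint : ∀ i, ∫ x, fderiv ℝ (G i) x (b i) = 0 := fun i => by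
    have := integral_mul_fderiv_eq_neg_fderiv_mul_of_integrable (μ := (volume : Measure (Eucl N)))
      (f := fun _ => (1 : ℝ)) (g := G i) (v := b i) (by simp)
      (by simpa using (hGd i).integrable_of_hasCompactSupport (hGds i))
      (by simpa using (hG i).continuous.integrable_of_hasCompactSupport (hGs i))
      (fun _ _ => differentiableAt_const _)
      (fun _ _ => (hG i).differentiable (by simp) _)
    simpa using this
  -- χ Δu is the divergence of χ ∇u: the gradient of χ is radial, and the radial derivative of u is
  -- zero by Euler's identity.
  have hsum : (fun x => χ x * lap u x) = fun x => ∑ i, fderiv ℝ (G i) x (b i) := by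
    ext x
    by_cases hx : x = 0
    · subst hx
      have : ∀ i, fderiv ℝ (G i) 0 = 0 := fun i => by
        have : G i =ᶠ[𝓝 0] fun _ => (0 : ℝ) := by
          filter_upwards [hχ0] with y hy
          simp [G, hy]
        rw [this.fderiv_eq]
        simp
      simp [this, hχ0.self_of_nhds]
    · have hd : ∀ i, fderiv ℝ (G i) x (b i) =
          χ x * deriv₂ u x (b i) (b i) + (2 * deriv η (‖x‖ ^ 2)) * (x i * fderiv ℝ u x (b i)) := by
        intro i
        have e1 : HasFDerivAt χ (deriv η (‖x‖ ^ 2) • (2 • innerSL ℝ x)) x :=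
          (η.contDiff.differentiable (n := ∞) (by simp) _).hasDerivAt.comp_hasFDerivAt x
            (hasStrictFDerivAt_norm_sq x).hasFDerivAt
        have e2 := ((hu.fderiv_apply (b i) x hx).differentiableAt (by simp)).hasFDerivAt
        have e3 : inner ℝ x (b i) = x i := by simp [b, EuclideanSpace.inner_single_right]
        have := (e1.fun_mul e2).fderiv
        change fderiv ℝ (G i) x = _ at this
        rw [this]
        simp [deriv₂, e3]
        ring
      have hE : ∑ i, x i * fderiv ℝ u x (b i) = 0 := by
        have := h0.fderiv_self hx ((hu x hx).differentiableAt (by simp))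
        rw [Int.cast_zero, zero_smul] at this
        rw [← this]
        conv_rhs => arg 2; rw [← sum_smul_single x]
        simp [b]
      simp only [hd, Finset.sum_add_distrib, ← Finset.mul_sum, hE, lap_eq]
      simp [b]
  change (Continuous fun x => χ x * lap u x) ∧ HasCompactSupport (fun x => χ x * lap u x) ∧
    ∫ x : Eucl N, χ x * lap u x = 0
  rw [hsum]
  refine ⟨continuous_finsetSum _ fun i _ => hGd i, ?_, ?_⟩
  · rw [← hsum]
    exact HasCompactSupport.of_support_subset_isCompact (isCompact_closedBall 0 (√(2 * R)))
      fun y hy => by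
        by_contra h
        exact hy (by simp [hχs y h])
  · rw [integral_finsetSum _ fun i _ => (hGd i).integrable_of_hasCompactSupport (hGds i)]
    simp [hint]

/-- A continuous nonnegative function with integral zero vanishes; the bump is centred at ‖x‖², so
that the weight at x is 1. -/
theorem lap_eq_zero_of_nonneg {u : Eucl N → ℝ} (hu : IsSmoothOffZero u)
    (h0 : IsHomogeneous 0 u) (hl : ∀ x, x ≠ 0 → 0 ≤ lap u x) {x : Eucl N} (hx : x ≠ 0) :
    lap u x = 0 := by
  have hR : 0 < ‖x‖ ^ 2 := by positivity
  let η : ContDiffBump (‖x‖ ^ 2) := ⟨‖x‖ ^ 2 / 4, ‖x‖ ^ 2 / 2, by positivity, by linarith⟩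
  obtain ⟨hc, hs, hi⟩ := integral_mul_lap_eq_zero hu h0 η (half_lt_self hR)
  by_contra hne
  refine (hc.integral_pos_of_hasCompactSupport_nonneg_nonzero (x := x) hs (fun y => ?_) ?_).ne' hi
  · by_cases hy : y = 0
    · have : η (‖y‖ ^ 2) = 0 := by
        apply η.zero_of_le_dist
        simp [hy, η]
      simp [this]
    · exact mul_nonneg η.nonneg (hl y hy)
  · have : η (‖x‖ ^ 2) = 1 := η.one_of_mem_closedBall (by simp [η]; positivity)
    simpa [this] using hne

/-- A subharmonic function that is homogeneous of degree zero has vanishing derivative. -/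
theorem fderiv_eq_zero_of_lap_nonneg {u : Eucl N → ℝ} (hu : IsSmoothOffZero u)
    (h0 : IsHomogeneous 0 u) (hl : ∀ x, x ≠ 0 → 0 ≤ lap u x) {x : Eucl N} (hx : x ≠ 0) :
    fderiv ℝ u x = 0 := by
  -- Once Δu = 0, one has Δ(u²) = 2|∇u|² ≥ 0, and u² is again homogeneous of degree zero; the
  -- vanishing result applied to u² gives ∇u = 0.
  have hu2 : IsSmoothOffZero fun x => u x ^ 2 := fun x hx => (hu x hx).pow 2
  have h02 : IsHomogeneous 0 fun x => u x ^ 2 := fun x hx r hr => by simp [h0 x hx r hr]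
  have hlap : ∀ x, x ≠ 0 → lap (fun x => u x ^ 2) x =
      2 * ∑ i : Fin N, fderiv ℝ u x (EuclideanSpace.single i 1) ^ 2 := fun x hx => by
    have := diffOp_inner (hu.two hx) (hu.two hx)
      (fun i : Fin N => EuclideanSpace.single i (1 : ℝ)) 0
    have hz := lap_eq_zero_of_nonneg hu h0 hl hx
    rw [lap] at hz
    rw [hz] at this
    simpa [lap, ← pow_two] using this
  have hz := lap_eq_zero_of_nonneg hu2 h02 (fun x hx => by rw [hlap x hx]; positivity) hx
  rw [hlap x hx] at hz
  have hz' : ∑ i : Fin N, fderiv ℝ u x (EuclideanSpace.single i 1) ^ 2 = 0 := by linarith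
  rw [Finset.sum_eq_zero_iff_of_nonneg (fun i _ => by positivity)] at hz'
  ext v
  rw [← sum_smul_single v, map_sum]
  refine Finset.sum_eq_zero fun i _ => ?_
  rw [map_smul, pow_eq_zero_iff (two_ne_zero) |>.1 (hz' i (Finset.mem_univ i)), smul_zero]

theorem eq_of_lap_nonneg (hN : 1 < N) {u : Eucl N → ℝ} (hu : IsSmoothOffZero u)
    (h0 : IsHomogeneous 0 u) (hl : ∀ x, x ≠ 0 → 0 ≤ lap u x) {x y : Eucl N} (hx : x ≠ 0)
    (hy : y ≠ 0) : u x = u y := by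
  have hc : IsPreconnected ({0}ᶜ : Set (Eucl N)) :=
    (isConnected_compl_singleton_of_one_lt_rank (by
      rw [← Module.finrank_eq_rank]; simpa using hN) 0).isPreconnected
  exact isOpen_compl_singleton.is_const_of_fderiv_eq_zero (𝕜 := ℝ) hc
    (fun z hz => ((hu z hz).differentiableAt (by simp)).differentiableWithinAt)
    (fun z hz => fderiv_eq_zero_of_lap_nonneg hu h0 hl hz) hx hy

/-- Constant-coefficient operators commute: Δ ∂ᵥ f = ∂ᵥ Δf, and Δf vanishes on a whole neighbourhood
of x. -/
theorem lap_fderiv_apply {f : Eucl N → F} (hf : IsSmoothOffZero f)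
    (hl : ∀ x, x ≠ 0 → lap f x = 0) (v : Eucl N) {x : Eucl N} (hx : x ≠ 0) :
    lap (fun y => fderiv ℝ f y v) x = 0 := by
  have h1 : ∀ w, deriv₂ (fun y => fderiv ℝ f y v) x w w =
      fderiv ℝ (fun y => deriv₂ f y w w) x v := fun w => by
    have h2 : (fun y => fderiv ℝ (fun y => fderiv ℝ f y v) y w) =ᶠ[𝓝 x]
        fun y => fderiv ℝ (fun y => fderiv ℝ f y w) y v := by
      filter_upwards [isOpen_ne.mem_nhds hx] with y hy using deriv₂_symm (hf.two hy) w v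
    rw [deriv₂, h2.fderiv_eq]
    exact deriv₂_symm ((hf.fderiv_apply w).two hx) w v
  rw [lap_eq]
  simp only [h1]
  have hd : ∀ w, DifferentiableAt ℝ (fun y => deriv₂ f y w w) x := fun w =>
    (((hf.fderiv_apply w).fderiv_apply w) x hx).differentiableAt (by simp)
  have h3 := fderiv_fun_sum (𝕜 := ℝ) (x := x) (u := Finset.univ)
    (A := fun (i : Fin N) y => deriv₂ f y (EuclideanSpace.single i 1) (EuclideanSpace.single i 1))
    fun i _ => hd _
  have h4 : (fun y => ∑ i : Fin N,
      deriv₂ f y (EuclideanSpace.single i 1) (EuclideanSpace.single i 1)) =ᶠ[𝓝 x]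
      fun _ => (0 : F) := by
    filter_upwards [isOpen_ne.mem_nhds hx] with y hy
    rw [← lap_eq, hl y hy]
  rw [h4.fderiv_eq] at h3
  have h5 := congrArg (fun A : Eucl N →L[ℝ] F => A v) h3
  simpa using h5.symm

/-- A harmonic function that is homogeneous of degree one is linear. -/
theorem exists_linear_of_lap_eq_zero (hN : 1 < N) {f : Eucl N → ℝ} (hf : IsSmoothOffZero f)
    (h1 : IsHomogeneous 1 f) (hl : ∀ x, x ≠ 0 → lap f x = 0) :
    ∃ A : Eucl N →L[ℝ] ℝ, ∀ x, x ≠ 0 → f x = A x := by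
  have : Nontrivial (Eucl N) := by
    have : Nonempty (Fin N) := ⟨⟨0, by omega⟩⟩
    infer_instance
  obtain ⟨x₀, hx₀⟩ := exists_ne (0 : Eucl N)
  -- Euler gives f(x) = Df(x)x. For fixed x the function y ↦ Df(y)x is harmonic of degree zero,
  -- hence constant, so Df(x)x = Df(x₀)x.
  refine ⟨fderiv ℝ f x₀, fun x hx => ?_⟩
  have h := h1.fderiv_self hx ((hf x hx).differentiableAt (by simp))
  rw [Int.cast_one, one_smul] at h
  rw [← h]
  exact eq_of_lap_nonneg hN (hf.fderiv_apply x) (by simpa using h1.fderiv_apply x)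
    (fun y hy => (lap_fderiv_apply hf hl x hy).ge) hx hx₀

end Homogeneous

/-! ### Curvature and exponential map of the sphere -/

section SphereGeometry

open Filter Topology

variable {n : ℕ}

theorem sphere_norm (p : Sph n) : ‖(p : Eucl (n + 1))‖ = 1 := by
  simp

theorem sphere_inner_self (p : Sph n) : inner ℝ (p : Eucl (n + 1)) (p : Eucl (n + 1)) = 1 := by
  rw [real_inner_self_eq_norm_sq, sphere_norm, one_pow]

theorem sphere_ne_zero (p : Sph n) : (p : Eucl (n + 1)) ≠ 0 := fun h => by
  simpa [h] using sphere_norm p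

theorem tangentPart_of_inner_eq_zero {p w : Eucl (n + 1)} (h : inner ℝ p w = 0) :
    tangentPart p w = w := by
  simp [tangentPart, h]

theorem tangentPart_add (p v w : Eucl (n + 1)) :
    tangentPart p (v + w) = tangentPart p v + tangentPart p w := by
  simp only [tangentPart, inner_add_right, add_smul]
  abel

theorem tangentPart_sub (p v w : Eucl (n + 1)) :
    tangentPart p (v - w) = tangentPart p v - tangentPart p w := by
  simp only [tangentPart, inner_sub_right, sub_smul]
  abel

theorem tangentPart_neg (p w : Eucl (n + 1)) : tangentPart p (-w) = -tangentPart p w := by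
  simp only [tangentPart, inner_neg_right, neg_smul]
  abel

theorem tangentPart_smul (p w : Eucl (n + 1)) (r : ℝ) :
    tangentPart p (r • w) = r • tangentPart p w := by
  simp only [tangentPart, inner_smul_right, smul_sub, smul_smul]

theorem tangentPart_sum {ι : Type*} (s : Finset ι) (p : Eucl (n + 1)) (w : ι → Eucl (n + 1)) :
    tangentPart p (∑ i ∈ s, w i) = ∑ i ∈ s, tangentPart p (w i) := by
  simp only [tangentPart, inner_sum, Finset.sum_smul, Finset.sum_sub_distrib]

theorem tangentPart_self {p : Eucl (n + 1)} (hp : inner ℝ p p = 1) : tangentPart p p = 0 := by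
  rw [tangentPart, hp, one_smul, sub_self]

theorem inner_tangentPart {p w v : Eucl (n + 1)} (hv : inner ℝ p v = 0) :
    inner ℝ (tangentPart p w) v = inner ℝ w v := by
  simp [tangentPart, inner_sub_left, inner_smul_left, hv]

/-- Differentiating the tangential part of a vector field along a map into the sphere. -/
theorem tangentPart_fderiv_tangentPart {E : Type*} [NormedAddCommGroup E] [NormedSpace ℝ E]
    {Φ G : E → Eucl (n + 1)} {x u : E} (hΦ : DifferentiableAt ℝ Φ x)
    (hG : DifferentiableAt ℝ G x) (h1 : inner ℝ (Φ x) (Φ x) = 1)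
    (h0 : inner ℝ (Φ x) (fderiv ℝ Φ x u) = 0) :
    tangentPart (Φ x) (fderiv ℝ (fun y => tangentPart (Φ y) (G y)) x u) =
      tangentPart (Φ x) (fderiv ℝ G x u) - inner ℝ (Φ x) (G x) • fderiv ℝ Φ x u := by
  have e : HasFDerivAt (fun y => tangentPart (Φ y) (G y)) _ x :=
    hG.hasFDerivAt.fun_sub ((hΦ.hasFDerivAt.inner ℝ hG.hasFDerivAt).fun_smul hΦ.hasFDerivAt)
  rw [e.fderiv]
  simp only [sub_apply, add_apply, smul_apply, ContinuousLinearMap.smulRight_apply,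
    tangentPart_sub, tangentPart_add, tangentPart_smul, tangentPart_self h1,
    tangentPart_of_inner_eq_zero h0]
  simp

theorem hasFDerivAt_tangentExtension (w q : Eucl (n + 1)) :
    HasFDerivAt (tangentExtension w)
      (-((innerSL ℝ w).smulRight q) - inner ℝ q w • ContinuousLinearMap.id ℝ _) q := by
  have h1 : HasFDerivAt (fun q : Eucl (n + 1) => inner ℝ q w) (innerSL ℝ w) q := by
    have := (innerSL ℝ w).hasFDerivAt (x := q)
    refine this.congr_of_eventuallyEq (Eventually.of_forall fun y => ?_)
    simp [real_inner_comm]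
  have := (hasFDerivAt_const w q).fun_sub (h1.fun_smul (hasFDerivAt_id q))
  refine this.congr_fderiv ?_
  ext1 v
  simp
  abel

theorem fderiv_tangentExtension (w q v : Eucl (n + 1)) :
    fderiv ℝ (tangentExtension w) q v = -(inner ℝ w v • q) - inner ℝ q w • v := by
  rw [(hasFDerivAt_tangentExtension w q).fderiv]
  simp

theorem tangentExtension_self {p w : Eucl (n + 1)} (h : inner ℝ p w = 0) :
    tangentExtension w p = w :=
  tangentPart_of_inner_eq_zero h

/-- The inner covariant derivative is the tangential part of -⟨c,Y⟩q - ⟨q,c⟩Y, with Y the extension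
of b. Differentiating along a at P, the term ⟨c,b⟩a cancels against the derivative of the
projection, and only the derivative of ⟨q,c⟩ survives. -/
theorem sphereNabla_sphereNabla {P a b c : Eucl (n + 1)} (hP : inner ℝ P P = 1)
    (ha : inner ℝ P a = 0) (hb : inner ℝ P b = 0) (hc : inner ℝ P c = 0) :
    sphereNabla (tangentExtension a)
      (sphereNabla (tangentExtension b) (tangentExtension c)) P = -(inner ℝ a c • b) := by
  have dY := (hasFDerivAt_tangentExtension b P).differentiableAt
  let G : Eucl (n + 1) → Eucl (n + 1) := fun q =>
    -(inner ℝ c (tangentExtension b q) • q) - inner ℝ q c • tangentExtension b q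
  have hG : sphereNabla (tangentExtension b) (tangentExtension c) =
      fun q => tangentPart (id q) (G q) := by
    ext1 q
    simp [sphereNabla, fderiv_tangentExtension, G]
  have e : HasFDerivAt G _ P :=
    ((((hasFDerivAt_const c P).inner ℝ dY.hasFDerivAt).fun_smul (hasFDerivAt_id P)).fun_neg).fun_sub
      (((hasFDerivAt_id P).inner ℝ (hasFDerivAt_const c P)).fun_smul dY.hasFDerivAt)
  rw [sphereNabla, hG]
  have := tangentPart_fderiv_tangentPart (Φ := id) (u := tangentExtension a P)
    differentiableAt_id e.differentiableAt hP
    (by simpa [tangentExtension_self ha] using ha)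
  rw [id_eq] at this
  rw [this, e.fderiv, tangentExtension_self ha]
  have hP' : ‖P‖ = 1 := by
    rw [real_inner_self_eq_norm_sq] at hP
    exact (pow_eq_one_iff_of_nonneg (norm_nonneg _) two_ne_zero).1 hP
  simp [G, tangentExtension_self hb, hc, tangentPart_sub, tangentPart_add, tangentPart_smul,
    tangentPart_neg, tangentPart_self hP, tangentPart_of_inner_eq_zero ha,
    tangentPart_of_inner_eq_zero hb, inner_sub_right, inner_smul_right, hb, hP',
    real_inner_comm c]
  abel

/-- The curvature tensor of the unit sphere. -/
theorem sphereCurvature_eq (p : Sph n) {a b c : Eucl (n + 1)}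
    (ha : inner ℝ (p : Eucl (n + 1)) a = 0) (hb : inner ℝ (p : Eucl (n + 1)) b = 0)
    (hc : inner ℝ (p : Eucl (n + 1)) c = 0) :
    sphereCurvature p a b c = inner ℝ a c • b - inner ℝ b c • a := by
  -- At p the derivative of the extension of w along a tangent v is -⟨w,v⟩p, symmetric in w and v;
  -- hence the bracket vanishes there.
  have h0 : VectorField.lieBracket ℝ (tangentExtension a) (tangentExtension b)
      (p : Eucl (n + 1)) = 0 := by
    rw [VectorField.lieBracket, fderiv_tangentExtension, fderiv_tangentExtension,
      tangentExtension_self ha, tangentExtension_self hb]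
    simp [ha, hb, real_inner_comm a b]
  have h1 : sphereNabla (VectorField.lieBracket ℝ (tangentExtension a) (tangentExtension b))
      (tangentExtension c) p = 0 := by
    rw [sphereNabla, h0, map_zero]
    simp [tangentPart]
  rw [sphereCurvature]
  simp only [h1, sphereNabla_sphereNabla (sphere_inner_self p) ha hb hc,
    sphereNabla_sphereNabla (sphere_inner_self p) hb ha hc]
  abel

/-! ### Great circles and the exponential map -/

/-- The energy |f'|² + k²|f|² is conserved and starts at zero, so f' = 0. The case k = 0, needed for
constant geodesics, is included. -/
theorem eq_zero_of_oscillator {E : Type*} [NormedAddCommGroup E] [InnerProductSpace ℝ E]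
    {k : ℝ} {f f' : ℝ → E} (h : ∀ t, HasDerivAt f (f' t) t)
    (h' : ∀ t, HasDerivAt f' (-(k ^ 2 • f t)) t) (h0 : f 0 = 0) (h0' : f' 0 = 0) (t : ℝ) :
    f t = 0 := by
  have hE : ∀ t, HasDerivAt (fun t => inner ℝ (f' t) (f' t) + k ^ 2 * inner ℝ (f t) (f t)) 0 t := by
    intro t
    have := ((h' t).inner ℝ (h' t)).fun_add (((h t).inner ℝ (h t)).const_mul (k ^ 2))
    refine this.congr_deriv ?_
    simp [inner_smul_left, inner_smul_right, real_inner_comm (f t)]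
    ring
  have hc : ∀ t, f' t = 0 := fun t => by
    have := is_const_of_deriv_eq_zero (fun t => (hE t).differentiableAt) (fun t => (hE t).deriv) t 0
    simp only [h0, h0', inner_zero_left, mul_zero, add_zero] at this
    have h1 : 0 ≤ inner ℝ (f' t) (f' t) := real_inner_self_nonneg
    have h2 : 0 ≤ inner ℝ (f t) (f t) := real_inner_self_nonneg
    have h3 : inner ℝ (f' t) (f' t) = 0 := by nlinarith [sq_nonneg k]
    exact inner_self_eq_zero.1 h3
  have := is_const_of_deriv_eq_zero (fun t => (h t).differentiableAt)
    (fun t => by rw [(h t).deriv, hc t]) t 0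
  rw [this, h0]

/-- The great circle `t ↦ exp_p (t v)`. -/
def greatCircle (p v : Eucl (n + 1)) (t : ℝ) : Eucl (n + 1) :=
  Real.cos (‖v‖ * t) • p + (Real.sin (‖v‖ * t) / ‖v‖) • v

/-- The velocity of the great circle. -/
def greatCircle' (p v : Eucl (n + 1)) (t : ℝ) : Eucl (n + 1) :=
  -((‖v‖ * Real.sin (‖v‖ * t)) • p) + Real.cos (‖v‖ * t) • v

theorem norm_div_norm_smul (v : Eucl (n + 1)) : (‖v‖ / ‖v‖) • v = v := by
  by_cases hv : v = 0
  · simp [hv]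
  · rw [div_self (norm_ne_zero_iff.2 hv), one_smul]

theorem hasDerivAt_greatCircle (p v : Eucl (n + 1)) (t : ℝ) :
    HasDerivAt (greatCircle p v) (greatCircle' p v t) t := by
  have h0 : HasDerivAt (fun t => ‖v‖ * t) ‖v‖ t := by
    simpa using (hasDerivAt_id t).const_mul ‖v‖
  have := (h0.cos.smul_const p).fun_add ((h0.sin.div_const ‖v‖).smul_const v)
  refine this.congr_deriv ?_
  rw [greatCircle', mul_div_assoc, mul_smul (Real.cos _), norm_div_norm_smul, neg_mul, neg_smul,
    mul_comm (Real.sin _)]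

theorem hasDerivAt_greatCircle' (p v : Eucl (n + 1)) (t : ℝ) :
    HasDerivAt (greatCircle' p v) (-(‖v‖ ^ 2 • greatCircle p v t)) t := by
  have h0 : HasDerivAt (fun t => ‖v‖ * t) ‖v‖ t := by
    simpa using (hasDerivAt_id t).const_mul ‖v‖
  have := ((h0.sin.const_mul ‖v‖).smul_const p).fun_neg.fun_add (h0.cos.smul_const v)
  refine this.congr_deriv ?_
  by_cases hv : v = 0
  · simp [hv]
  have hv' := norm_ne_zero_iff.2 hv
  rw [greatCircle, smul_add, smul_smul, smul_smul, neg_add, ← neg_smul, ← neg_smul, ← neg_smul]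
  congr 2
  · ring
  · field_simp

theorem norm_greatCircle {p v : Eucl (n + 1)} (hp : ‖p‖ = 1) (hv : inner ℝ p v = 0) (t : ℝ) :
    ‖greatCircle p v t‖ = 1 := by
  have : ‖greatCircle p v t‖ ^ 2 = 1 := by
    rw [greatCircle, norm_add_sq_real, inner_smul_left, inner_smul_right, hv, norm_smul, norm_smul,
      hp, mul_pow, mul_pow, Real.norm_eq_abs, Real.norm_eq_abs, sq_abs, sq_abs, div_pow]
    by_cases h : v = 0
    · simp [h]
    · have h := norm_ne_zero_iff.2 h
      field_simp
      simp only [conj_trivial, mul_zero, add_zero]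
      linear_combination ‖v‖ * Real.cos_sq_add_sin_sq (‖v‖ * t)
  exact (pow_eq_one_iff_of_nonneg (norm_nonneg _) two_ne_zero).1 this

/-- Write c for γ in Euclidean space. Differentiating ⟨c,c⟩ = 1 twice gives c ⟂ c' and ⟨c,c''⟩ =
-|c'|². Since c'' is a multiple of c, the speed is constant and c'' = -|v|²c. The great circle
solves the same equation with the same initial data. -/
theorem geodesic_eq_greatCircle {γ : ℝ → Sph n} (hγ : IsGeodesic γ) {p : Sph n}
    {v : Eucl (n + 1)} (h0 : γ 0 = p)
    (h1 : deriv (fun t => (γ t : Eucl (n + 1))) 0 = v) (t : ℝ) :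
    (γ t : Eucl (n + 1)) = greatCircle (p : Eucl (n + 1)) v t := by
  let c : ℝ → Eucl (n + 1) := fun t => γ t
  have hc : ContDiff ℝ ∞ c := hγ.1
  have hc' : ContDiff ℝ ∞ (deriv c) := by
    have h : ContDiff ℝ (∞ + 1) c := by simpa using hc
    exact (contDiff_succ_iff_deriv.1 h).2.2
  have d1 : ∀ t, HasDerivAt c (deriv c t) t := fun t =>
    (hc.differentiable (by simp) t).hasDerivAt
  have d2 : ∀ t, HasDerivAt (deriv c) (deriv (deriv c) t) t := fun t =>
    (hc'.differentiable (by simp) t).hasDerivAt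
  have i0 : ∀ t, inner ℝ (c t) (c t) = 1 := fun t => sphere_inner_self (γ t)
  have i1 : ∀ t, inner ℝ (c t) (deriv c t) = 0 := fun t => by
    have e := (d1 t).inner ℝ (d1 t)
    have : (fun t => inner ℝ (c t) (c t)) = fun _ => (1 : ℝ) := funext i0
    rw [this] at e
    have := e.unique (hasDerivAt_const t 1)
    rw [real_inner_comm (c t)] at this
    linarith
  have i2 : ∀ t, deriv (deriv c) t = inner ℝ (c t) (deriv (deriv c) t) • c t := fun t =>
    sub_eq_zero.1 (hγ.2 t)
  have i3 : ∀ t, inner ℝ (c t) (deriv (deriv c) t) = -‖deriv c t‖ ^ 2 := fun t => by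
    have e := (d1 t).inner ℝ (d2 t)
    have : (fun t => inner ℝ (c t) (deriv c t)) = fun _ => (0 : ℝ) := funext i1
    rw [this] at e
    have := e.unique (hasDerivAt_const t 0)
    rw [real_inner_self_eq_norm_sq] at this
    linarith
  have i4 : ∀ t, ‖deriv c t‖ ^ 2 = ‖v‖ ^ 2 := fun t => by
    have e : ∀ t, HasDerivAt (fun t => inner ℝ (deriv c t) (deriv c t)) 0 t := fun t => by
      refine ((d2 t).inner ℝ (d2 t)).congr_deriv ?_
      have : inner ℝ (deriv c t) (deriv (deriv c) t) = 0 := by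
        rw [i2 t, inner_smul_right, real_inner_comm (c t) (deriv c t), i1 t, mul_zero]
      rw [real_inner_comm (deriv c t) (deriv (deriv c) t), this, add_zero]
    have := is_const_of_deriv_eq_zero (fun t => (e t).differentiableAt) (fun t => (e t).deriv) t 0
    simp only [real_inner_self_eq_norm_sq] at this
    rw [this]
    exact congrArg (fun w => ‖w‖ ^ 2) h1
  have := eq_zero_of_oscillator (k := ‖v‖) (f := fun t => c t - greatCircle (p : Eucl (n + 1)) v t)
    (f' := fun t => deriv c t - greatCircle' (p : Eucl (n + 1)) v t)
    (fun t => (d1 t).fun_sub (hasDerivAt_greatCircle _ _ t))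
    (fun t => ((d2 t).fun_sub (hasDerivAt_greatCircle' _ _ t)).congr_deriv (by
      rw [i2 t, i3 t, i4 t, smul_sub, neg_smul]; abel))
    (by simp [c, h0, greatCircle]) (by simp [c, h1, greatCircle']) t
  exact sub_eq_zero.1 this

theorem sphereExp_eq (p : Sph n) {v : Eucl (n + 1)}
    (hv : inner ℝ (p : Eucl (n + 1)) v = 0) :
    (sphereExp p v : Eucl (n + 1)) =
      Real.cos ‖v‖ • (p : Eucl (n + 1)) + (Real.sin ‖v‖ / ‖v‖) • v := by
  have h : ∃ γ : ℝ → Sph n, IsGeodesic γ ∧ γ 0 = p ∧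
      deriv (fun t => (γ t : Eucl (n + 1))) 0 = v := by
    have e1 : deriv (greatCircle (p : Eucl (n + 1)) v) = greatCircle' (p : Eucl (n + 1)) v :=
      funext fun t => (hasDerivAt_greatCircle _ _ t).deriv
    have hs : ContDiff ℝ ∞ (greatCircle (p : Eucl (n + 1)) v) := by
      unfold greatCircle
      fun_prop
    refine ⟨fun t => ⟨greatCircle p v t, by simpa using norm_greatCircle (sphere_norm p) hv t⟩,
      ⟨hs, fun t => ?_⟩, ?_, ?_⟩
    · change tangentPart (greatCircle (p : Eucl (n + 1)) v t)
        (deriv (deriv (greatCircle (p : Eucl (n + 1)) v)) t) = 0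
      rw [e1, (hasDerivAt_greatCircle' _ _ t).deriv, ← neg_smul, tangentPart_smul,
        tangentPart_self, smul_zero]
      rw [real_inner_self_eq_norm_sq, norm_greatCircle (sphere_norm p) hv, one_pow]
    · ext1
      simp [greatCircle]
    · change deriv (greatCircle (p : Eucl (n + 1)) v) 0 = v
      rw [e1]
      simp [greatCircle']
  rw [sphereExp, dif_pos h]
  obtain ⟨h1, h2, h3⟩ := h.choose_spec
  rw [geodesic_eq_greatCircle h1 h2 h3]
  simp [greatCircle]

end SphereGeometry

/-! ### The Laplacian of vector-valued maps in the preferred chart -/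

section ChartLaplacian

open Filter Topology

variable {m n : ℕ} {M : Type*} [TopologicalSpace M] [ChartedSpace (Eucl m) M]
  [IsManifold (𝓡 m) ∞ M] {F : Type*} [NormedAddCommGroup F] [NormedSpace ℝ F]

/-- The componentwise Laplacian of a vector-valued map at `x`. -/
def mapLap (g : SmoothMetric m M) (f : M → F) (x : M) : F :=
  diffOp (frame g x) (∑ i, christoffel g x (frame g x i) (frame g x i)) (inChart x f) (center x)

theorem laplacian_eq_mapLap (g : SmoothMetric m M) (f : M → ℝ) (x : M) :
    laplacian g f x = mapLap g f x := by
  simp [laplacian, mapLap, diffOp, deriv₂]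

@[simp] theorem inChart_center {W : Type*} (x : M) (f : M → W) :
    inChart (m := m) x f (center x) = f x := by
  simp [inChart, center]

theorem contDiffAt_inChart {f : M → F} {x : M} (hf : ContMDiffAt (𝓡 m) 𝓘(ℝ, F) ∞ f x) :
    ContDiffAt ℝ ∞ (inChart (m := m) x f) (center x) := by
  have h := (contMDiffAt_iff.1 hf).2
  simp only [ModelWithCorners.range_eq_univ, contDiffWithinAt_univ] at h
  exact h

theorem fderiv_inChart {f : M → F} {x : M} (hf : MDifferentiableAt (𝓡 m) 𝓘(ℝ, F) f x) (u : Eucl m) :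
    fderiv ℝ (inChart x f) (center x) u = mfderiv (𝓡 m) 𝓘(ℝ, F) f x u := by
  rw [hf.mfderiv]
  simp only [ModelWithCorners.range_eq_univ, fderivWithin_univ]
  rfl

theorem contDiffAt_two {E : Type*} [NormedAddCommGroup E] [NormedSpace ℝ E] {f : E → F} {x : E}
    (hf : ContDiffAt ℝ ∞ f x) : ContDiffAt ℝ 2 f x :=
  hf.of_le (WithTop.coe_le_coe.2 le_top)

theorem contMDiff_coe {φ : M → Sph n} (hφ : ContMDiff (𝓡 m) (𝓡 n) ∞ φ) :
    ContMDiff (𝓡 m) 𝓘(ℝ, Eucl (n + 1)) ∞ fun z => (φ z : Eucl (n + 1)) := by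
  have := finrank_fact n
  exact (contMDiff_coe_sphere (E := Eucl (n + 1)) (n := n)).comp hφ

variable {φ : M → Sph n}

theorem inner_map_mapDeriv (hφ : ContMDiff (𝓡 m) (𝓡 n) ∞ φ) (x : M) (u : Eucl m) :
    inner ℝ (φ x : Eucl (n + 1)) (mapDeriv φ x u (center x)) = 0 := by
  have hd := ((contDiffAt_inChart (contMDiff_coe hφ x)).differentiableAt (by simp)).hasFDerivAt
  have h1 := hd.inner ℝ hd
  have h2 : (fun y => inner ℝ (inChart (m := m) x (fun z => (φ z : Eucl (n + 1))) y)
      (inChart x (fun z => (φ z : Eucl (n + 1))) y)) = fun _ => (1 : ℝ) :=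
    funext fun y => sphere_inner_self _
  rw [h2] at h1
  have h3 := congrArg (fun A : Eucl m →L[ℝ] ℝ => A u) (h1.unique (hasFDerivAt_const 1 _))
  simp only [ContinuousLinearMap.comp_apply, ContinuousLinearMap.prod_apply,
    fderivInnerCLM_apply, zero_apply, inChart_center] at h3
  rw [real_inner_comm (φ x : Eucl (n + 1))] at h3
  change inner ℝ (φ x : Eucl (n + 1)) (mapDeriv φ x u (center x)) +
    inner ℝ (φ x : Eucl (n + 1)) (mapDeriv φ x u (center x)) = 0 at h3
  linarith

/-- The Christoffel term is an image of dφ, hence already tangent, so the projection can be taken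
outside the trace. -/
theorem tension_eq (g : SmoothMetric m M) (hφ : ContMDiff (𝓡 m) (𝓡 n) ∞ φ) (x : M) :
    tension g φ x =
      tangentPart (φ x : Eucl (n + 1)) (mapLap g (fun z => (φ z : Eucl (n + 1))) x) := by
  have h1 : ∀ u, mapDeriv φ x u (center x) =
      tangentPart (φ x : Eucl (n + 1)) (mapDeriv φ x u (center x)) := fun u =>
    (tangentPart_of_inner_eq_zero (inner_map_mapDeriv hφ x u)).symm
  rw [tension, mapLap, diffOp, map_sum, ← Finset.sum_sub_distrib, tangentPart_sum]
  refine Finset.sum_congr rfl fun i _ => ?_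
  rw [secondForm, h1, ← tangentPart_sub]
  rfl

/-- The energy density (up to the factor `1/2`) of a map into the sphere. -/
def energy (g : SmoothMetric m M) (φ : M → Sph n) (x : M) : ℝ :=
  ∑ i, inner ℝ (mapDeriv φ x (frame g x i) (center x)) (mapDeriv φ x (frame g x i) (center x))

/-- Apply the Laplacian to ⟨φ,φ⟩ = 1. -/
theorem inner_mapLap (g : SmoothMetric m M) (hφ : ContMDiff (𝓡 m) (𝓡 n) ∞ φ) (x : M) :
    inner ℝ (φ x : Eucl (n + 1)) (mapLap g (fun z => (φ z : Eucl (n + 1))) x) =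
      - energy g φ x := by
  have hd := contDiffAt_two (contDiffAt_inChart (contMDiff_coe hφ x))
  have h1 := diffOp_inner hd hd (frame g x) (∑ i, christoffel g x (frame g x i) (frame g x i))
  have h2 : (fun y => inner ℝ (inChart (m := m) x (fun z => (φ z : Eucl (n + 1))) y)
      (inChart x (fun z => (φ z : Eucl (n + 1))) y)) = fun _ => (1 : ℝ) :=
    funext fun y => sphere_inner_self _
  rw [h2, diffOp_const, inChart_center, real_inner_comm (φ x : Eucl (n + 1))] at h1
  change 0 = inner ℝ (φ x : Eucl (n + 1)) (mapLap g (fun z => (φ z : Eucl (n + 1))) x)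
    + 2 * energy g φ x
    + inner ℝ (φ x : Eucl (n + 1)) (mapLap g (fun z => (φ z : Eucl (n + 1))) x) at h1
  linarith

theorem IsHarmonicMap.mapLap_eq {g : SmoothMetric m M} (hφ : IsHarmonicMap g φ) (x : M) :
    mapLap g (fun z => (φ z : Eucl (n + 1))) x = -energy g φ x • (φ x : Eucl (n + 1)) := by
  have h := hφ.2 x
  rw [tension_eq g hφ.1, tangentPart, sub_eq_zero] at h
  rw [h, inner_mapLap g hφ.1]

theorem frame_orthonormal (g : SmoothMetric m M) (x : M) (i j : Fin m) :
    g.inner x (frame g x i) (frame g x j) = if i = j then 1 else 0 :=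
  (exists_orthonormalFrame g x).choose_spec i j

theorem span_frame (g : SmoothMetric m M) (x : M) :
    Submodule.span ℝ (Set.range (frame g x)) = ⊤ := by
  have hli : LinearIndependent ℝ (frame g x) := by
    rw [Fintype.linearIndependent_iff]
    intro a ha i
    let L : Eucl m →L[ℝ] ℝ := g.inner x (frame g x i)
    have h1 : ∑ j, a j * L (frame g x j) = 0 := by
      simpa using congrArg L ha
    have h2 : ∀ j, L (frame g x j) = if i = j then 1 else 0 := frame_orthonormal g x i
    simpa [h2] using h1
  exact hli.span_eq_top_of_card_eq_finrank' (by simp)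

theorem clm_eq_zero_of_frame (g : SmoothMetric m M) (x : M) {A : Eucl m →L[ℝ] F}
    (h : ∀ i, A (frame g x i) = 0) : A = 0 := by
  have : (A : Eucl m →ₗ[ℝ] F) = 0 :=
    LinearMap.ext_on_range (span_frame g x) fun i => by simpa using h i
  ext1 v
  exact LinearMap.congr_fun this v

theorem exists_mapDeriv_frame_ne_zero (g : SmoothMetric m M) (hn : 1 ≤ n)
    (hφ : ContMDiff (𝓡 m) (𝓡 n) ∞ φ) (x : M)
    (hsub : Function.Surjective (mfderiv (𝓡 m) (𝓡 n) φ x)) :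
    ∃ i, mapDeriv φ x (frame g x i) (center x) ≠ 0 := by
  by_contra! h
  have := finrank_fact n
  have h0 := clm_eq_zero_of_frame g x
    (A := fderiv ℝ (inChart x fun z => (φ z : Eucl (n + 1))) (center x)) h
  have hd : MDifferentiableAt (𝓡 m) (𝓡 n) φ x := (hφ x).mdifferentiableAt (by simp)
  have hc : MDifferentiableAt (𝓡 n) 𝓘(ℝ, Eucl (n + 1)) (Subtype.val : Sph n → Eucl (n + 1)) (φ x) :=
    (contMDiff_coe_sphere (m := 1) (φ x)).mdifferentiableAt (by simp)
  have h1 : ∀ u : TangentSpace (𝓡 m) x, inclDeriv n (φ x) (mfderiv (𝓡 m) (𝓡 n) φ x u) = 0 := by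
    intro u
    have e1 := fderiv_inChart ((contMDiff_coe hφ x).mdifferentiableAt (by simp)) u
    rw [h0] at e1
    have e2 := mfderiv_comp x hc hd
    have e3 := congrArg (fun A : TangentSpace (𝓡 m) x →L[ℝ] Eucl (n + 1) => A u) e2
    exact e3.symm.trans e1.symm
  have h2 : ∀ w : TangentSpace (𝓡 n) (φ x), w = 0 := fun w => by
    obtain ⟨u, rfl⟩ := hsub w
    exact injective_mvfderiv_subtypeVal_sphere (φ x) ((h1 u).trans (map_zero _).symm)
  have h3 : (EuclideanSpace.single (⟨0, hn⟩ : Fin n) (1 : ℝ) : Eucl n) = 0 := h2 _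
  simp at h3

end ChartLaplacian

/-! ### Harmonic functions on the round sphere -/

section RoundLaplacian

open Filter Topology

variable {m n : ℕ} {M : Type*} [TopologicalSpace M] [ChartedSpace (Eucl m) M]
  [IsManifold (𝓡 m) ∞ M] {F G : Type*} [NormedAddCommGroup F] [NormedSpace ℝ F]
  [NormedAddCommGroup G] [NormedSpace ℝ G]

theorem mapLap_comp (g : SmoothMetric m M) {f : M → F} {h : F → G} {x : M}
    (hf : ContMDiffAt (𝓡 m) 𝓘(ℝ, F) ∞ f x) (hh : ContDiffAt ℝ 2 h (f x)) :
    mapLap g (fun z => h (f z)) x =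
      ∑ i, deriv₂ h (f x) (fderiv ℝ (inChart x f) (center x) (frame g x i))
        (fderiv ℝ (inChart x f) (center x) (frame g x i)) + fderiv ℝ h (f x) (mapLap g f x) := by
  have h1 := diffOp_comp (f := inChart (m := m) x f) (h := h) (x := center x)
    (by simpa using hh) (contDiffAt_two (contDiffAt_inChart hf)) (frame g x)
    (∑ i, christoffel g x (frame g x i) (frame g x i))
  rw [inChart_center] at h1
  exact h1

/-- The inclusion of the sphere, read in the preferred chart at `p`. -/
def chartIncl (p : Sph n) : Eucl n → Eucl (n + 1) := inChart p fun q : Sph n => (q : Eucl (n + 1))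

theorem contDiffAt_chartIncl (p : Sph n) : ContDiffAt ℝ ∞ (chartIncl p) (center p) :=
  contDiffAt_inChart (contMDiff_coe contMDiff_id p)

theorem inclDeriv_coordField (p : Sph n) {y : Eucl n} (hy : y ∈ (extChartAt (𝓡 n) p).target)
    (u : Eucl n) :
    inclDeriv n ((extChartAt (𝓡 n) p).symm y) (coordField p u y) = fderiv ℝ (chartIncl p) y u := by
  have := finrank_fact n
  have hd : MDifferentiableAt 𝓘(ℝ, Eucl n) (𝓡 n) (extChartAt (𝓡 n) p).symm y :=
    ((contMDiffOn_extChartAt_symm (n := 1) p).contMDiffAt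
      ((isOpen_extChartAt_target p).mem_nhds hy)).mdifferentiableAt (by simp)
  have hc : MDifferentiableAt (𝓡 n) 𝓘(ℝ, Eucl (n + 1)) (Subtype.val : Sph n → Eucl (n + 1))
      ((extChartAt (𝓡 n) p).symm y) :=
    (contMDiff_coe_sphere (m := 1) _).mdifferentiableAt (by simp)
  have e := mfderiv_comp y hc hd
  have e2 : mfderiv 𝓘(ℝ, Eucl n) 𝓘(ℝ, Eucl (n + 1))
      ((Subtype.val : Sph n → Eucl (n + 1)) ∘ (extChartAt (𝓡 n) p).symm) y =
      fderiv ℝ (chartIncl p) y := mfderiv_eq_fderiv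
  have e3 := congrArg (fun A : Eucl n →L[ℝ] Eucl (n + 1) => A u) (e2.symm.trans e)
  exact e3.symm

theorem metricCoeff_roundMetric (p : Sph n) (u v : Eucl n) :
    metricCoeff (roundMetric n) p u v =ᶠ[𝓝 (center p)] fun y =>
      inner ℝ (fderiv ℝ (chartIncl p) y u) (fderiv ℝ (chartIncl p) y v) := by
  filter_upwards [extChartAt_target_mem_nhds (I := 𝓡 n) p] with y hy
  rw [← inclDeriv_coordField p hy, ← inclDeriv_coordField p hy]
  rfl

theorem fderiv_metricCoeff_roundMetric (p : Sph n) (u v w : Eucl n) :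
    fderiv ℝ (metricCoeff (roundMetric n) p v w) (center p) u =
      inner ℝ (fderiv ℝ (chartIncl p) (center p) v) (deriv₂ (chartIncl p) (center p) u w)
        + inner ℝ (deriv₂ (chartIncl p) (center p) u v) (fderiv ℝ (chartIncl p) (center p) w) := by
  have hd := differentiableAt_fderiv (contDiffAt_two (contDiffAt_chartIncl p))
  have h1 : ∀ v, DifferentiableAt ℝ (fun y => fderiv ℝ (chartIncl p) y v) (center p) := fun v =>
    hd.clm_apply (differentiableAt_const v)
  rw [(metricCoeff_roundMetric p v w).fderiv_eq,
    ((h1 v).hasFDerivAt.inner ℝ (h1 w).hasFDerivAt).fderiv]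
  rfl

/-- In the Koszul formula for an induced metric, symmetry of second derivatives cancels all terms
except the two equal ones with ∂ᵤ∂ᵥ. -/
theorem christoffelLower_roundMetric (p : Sph n) (u v w : Eucl n) :
    christoffelLower (roundMetric n) p u v w =
      inner ℝ (deriv₂ (chartIncl p) (center p) u v) (fderiv ℝ (chartIncl p) (center p) w) := by
  have h2 := contDiffAt_two (contDiffAt_chartIncl p)
  rw [christoffelLower, fderiv_metricCoeff_roundMetric, fderiv_metricCoeff_roundMetric,
    fderiv_metricCoeff_roundMetric, deriv₂_symm h2 v u, deriv₂_symm h2 w u, deriv₂_symm h2 w v,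
    real_inner_comm (deriv₂ (chartIncl p) (center p) u w)]
  ring

theorem inner_fderiv_chartIncl_frame (p : Sph n) (i j : Fin n) :
    inner ℝ (fderiv ℝ (chartIncl p) (center p) (frame (roundMetric n) p i))
      (fderiv ℝ (chartIncl p) (center p) (frame (roundMetric n) p j)) =
      if i = j then 1 else 0 := by
  have h1 : ∀ u, fderiv ℝ (chartIncl p) (center p) u = inclDeriv n p u := fun u =>
    fderiv_inChart ((contMDiff_coe contMDiff_id p).mdifferentiableAt (by simp)) u
  rw [← frame_orthonormal (roundMetric n) p i j, h1, h1]
  rfl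

theorem inner_chartIncl_fderiv (p : Sph n) (u : Eucl n) :
    inner ℝ (p : Eucl (n + 1)) (fderiv ℝ (chartIncl p) (center p) u) = 0 :=
  inner_map_mapDeriv (φ := fun q : Sph n => q) contMDiff_id p u

/-- Parseval's identity for an orthonormal frame of the orthogonal complement of `p`. -/
theorem sum_inner_mul_inner_of_orthonormal {p : Eucl (n + 1)} (hp : inner ℝ p p = 1)
    {τ : Fin n → Eucl (n + 1)} (hτ : ∀ i j, inner ℝ (τ i) (τ j) = if i = j then (1 : ℝ) else 0)
    (hpτ : ∀ i, inner ℝ p (τ i) = 0) (a b : Eucl (n + 1)) :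
    ∑ i, inner ℝ a (τ i) * inner ℝ (τ i) b = inner ℝ a b - inner ℝ a p * inner ℝ p b := by
  have ho : Orthonormal ℝ (Fin.cons p τ : Fin (n + 1) → Eucl (n + 1)) := by
    rw [orthonormal_iff_ite]
    intro i j
    refine Fin.cases ?_ (fun i => ?_) i <;> refine Fin.cases ?_ (fun j => ?_) j
    · simpa using hp
    · simpa [(Fin.succ_ne_zero j).symm] using hpτ j
    · simpa [Fin.succ_ne_zero, real_inner_comm] using hpτ i
    · simpa using hτ i j
  have hs : ⊤ ≤ Submodule.span ℝ (Set.range (Fin.cons p τ : Fin (n + 1) → Eucl (n + 1))) :=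
    (ho.linearIndependent.span_eq_top_of_card_eq_finrank' (by simp)).ge
  have := (OrthonormalBasis.mk ho hs).sum_inner_mul_inner a b
  rw [Fin.sum_univ_succ] at this
  simp only [OrthonormalBasis.coe_mk, Fin.cons_zero, Fin.cons_succ] at this
  linarith

/-- The identity of the round sphere is a harmonic map. -/
theorem tangentPart_mapLap_coe (p : Sph n) :
    tangentPart (p : Eucl (n + 1))
      (mapLap (roundMetric n) (fun q : Sph n => (q : Eucl (n + 1))) p) = 0 := by
  set g := roundMetric n
  let τ : Fin n → Eucl (n + 1) := fun i => fderiv ℝ (chartIncl p) (center p) (frame g p i)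
  -- Gauss's formula: the image of the Christoffel vector is the tangential projection of the second
  -- derivative of the inclusion. Each term of the trace is therefore normal.
  have h1 : ∀ u v, fderiv ℝ (chartIncl p) (center p) (christoffel g p u v) =
      ∑ j, inner ℝ (deriv₂ (chartIncl p) (center p) u v) (τ j) • τ j := fun u v => by
    simp only [christoffel, map_sum, map_smul, g, christoffelLower_roundMetric, τ]
  have h2 : mapLap g (fun q : Sph n => (q : Eucl (n + 1))) p =
      ∑ i, (deriv₂ (chartIncl p) (center p) (frame g p i) (frame g p i) -
        fderiv ℝ (chartIncl p) (center p) (christoffel g p (frame g p i) (frame g p i))) := by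
    rw [Finset.sum_sub_distrib, ← map_sum]
    rfl
  rw [h2, tangentPart_sum]
  refine Finset.sum_eq_zero fun i _ => ?_
  rw [h1]
  refine ext_inner_right ℝ fun b => ?_
  have hb : ∀ w : Eucl (n + 1), inner ℝ (tangentPart (p : Eucl (n + 1)) w) b =
      inner ℝ w b - inner ℝ (p : Eucl (n + 1)) w * inner ℝ (p : Eucl (n + 1)) b := fun w => by
    simp [tangentPart, inner_sub_left, inner_smul_left]
  have hp := sum_inner_mul_inner_of_orthonormal (sphere_inner_self p)
    (inner_fderiv_chartIncl_frame p) (fun i => inner_chartIncl_fderiv p _)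
    (deriv₂ (chartIncl p) (center p) (frame g p i) (frame g p i)) b
  have hp0 : ∀ j, inner ℝ (p : Eucl (n + 1)) (τ j) = 0 := fun j => inner_chartIncl_fderiv p _
  change ∑ j, inner ℝ _ (τ j) * inner ℝ (τ j) b = _ at hp
  rw [hb, inner_sub_left, sum_inner, inner_sub_right, inner_sum]
  simp only [inner_smul_left, inner_smul_right, conj_trivial, hp, hp0, mul_zero,
    Finset.sum_const_zero, sub_zero, inner_zero_left]
  rw [real_inner_comm (p : Eucl (n + 1))]
  ring

/-! ### Angle functions -/

/-- The angle in the oriented plane spanned by `u` and `v`. -/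
def angle (u v x : Eucl (n + 1)) : ℝ := Real.arctan (inner ℝ v x / inner ℝ u x)

theorem contDiffAt_angle (u v : Eucl (n + 1)) {x : Eucl (n + 1)} (hx : 0 < inner ℝ u x) :
    ContDiffAt ℝ ∞ (angle u v) x := by
  refine Real.contDiff_arctan.contDiffAt.comp x (ContDiffAt.div ?_ ?_ hx.ne')
  · exact (innerSL ℝ v).contDiff.contDiffAt
  · exact (innerSL ℝ u).contDiff.contDiffAt

theorem fderiv_angle (u v : Eucl (n + 1)) {x : Eucl (n + 1)} (hx : 0 < inner ℝ u x)
    (w : Eucl (n + 1)) :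
    fderiv ℝ (angle u v) x w =
      (inner ℝ v w * inner ℝ u x - inner ℝ v x * inner ℝ u w) /
        (inner ℝ u x ^ 2 + inner ℝ v x ^ 2) := by
  rw [← ((contDiffAt_angle u v hx).differentiableAt (by simp)).lineDeriv_eq_fderiv, lineDeriv]
  have h : ∀ a : Eucl (n + 1), HasDerivAt (fun t : ℝ => inner ℝ a (x + t • w)) (inner ℝ a w) 0 := by
    intro a
    simp only [inner_add_right, inner_smul_right]
    simpa using ((hasDerivAt_id (0 : ℝ)).mul_const (inner ℝ a w)).const_add (inner ℝ a x)
  have hd : HasDerivAt (fun t : ℝ => angle u v (x + t • w)) _ 0 :=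
    ((h v).fun_div (h u) (by simpa using hx.ne')).arctan
  rw [hd.deriv]
  have := hx.ne'
  simp only [zero_smul, add_zero]
  field_simp

theorem deriv₂_angle (u v : Eucl (n + 1)) {x : Eucl (n + 1)} (hx : 0 < inner ℝ u x)
    (w : Eucl (n + 1)) :
    deriv₂ (angle u v) x w w =
      -2 * ((inner ℝ v w * inner ℝ u x - inner ℝ v x * inner ℝ u w) *
        (inner ℝ u x * inner ℝ u w + inner ℝ v x * inner ℝ v w)) /
        (inner ℝ u x ^ 2 + inner ℝ v x ^ 2) ^ 2 := by
  have hev : ∀ᶠ y in 𝓝 x, 0 < inner ℝ u y := by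
    have hc : Continuous fun y : Eucl (n + 1) => inner ℝ u y := by fun_prop
    exact hc.continuousAt.eventually_const_lt hx
  have hdiff : DifferentiableAt ℝ (fun y => fderiv ℝ (angle u v) y w) x :=
    (differentiableAt_fderiv (contDiffAt_two (contDiffAt_angle u v hx))).clm_apply
      (differentiableAt_const w)
  rw [deriv₂, ← hdiff.lineDeriv_eq_fderiv, lineDeriv]
  have hline : Tendsto (fun t : ℝ => x + t • w) (𝓝 0) (𝓝 x) := by
    have : Continuous fun t : ℝ => x + t • w := by fun_prop
    simpa using this.tendsto 0
  -- Along the line x + t w the numerator of the first derivative does not depend on t; only the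
  -- denominator has to be differentiated.
  have he : (fun t : ℝ => fderiv ℝ (angle u v) (x + t • w) w) =ᶠ[𝓝 0] fun t =>
      (inner ℝ v w * inner ℝ u x - inner ℝ v x * inner ℝ u w) /
        ((inner ℝ u x + t * inner ℝ u w) ^ 2 + (inner ℝ v x + t * inner ℝ v w) ^ 2) := by
    filter_upwards [hline.eventually hev] with t ht
    rw [fderiv_angle u v ht]
    simp only [inner_add_right, inner_smul_right]
    congr 1
    ring
  rw [he.deriv_eq]
  have h : ∀ a b : ℝ, HasDerivAt (fun t : ℝ => a + t * b) b 0 := fun a b => by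
    simpa using ((hasDerivAt_id (0 : ℝ)).mul_const b).const_add a
  have hpos : 0 < inner ℝ u x ^ 2 + inner ℝ v x ^ 2 := by positivity
  have hd := (hasDerivAt_const (0 : ℝ)
    (inner ℝ v w * inner ℝ u x - inner ℝ v x * inner ℝ u w)).fun_div
    (((h (inner ℝ u x) (inner ℝ u w)).fun_pow 2).fun_add
      ((h (inner ℝ v x) (inner ℝ v w)).fun_pow 2))
    (by simpa using hpos.ne')
  rw [hd.deriv]
  simp only [zero_mul, add_zero, zero_sub]
  congr 1
  push_cast
  ring

/-- Angle functions are harmonic on the sphere. -/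
theorem isHarmonicFunctionOn_angle {u v : Eucl (n + 1)} (h : inner ℝ u u = inner ℝ v v)
    (huv : inner ℝ u v = 0) :
    IsHarmonicFunctionOn (roundMetric n) (fun q : Sph n => angle u v (q : Eucl (n + 1)))
      {q | 0 < inner ℝ u (q : Eucl (n + 1))} := by
  have hs : ContMDiff (𝓡 n) 𝓘(ℝ, Eucl (n + 1)) ∞ fun q : Sph n => (q : Eucl (n + 1)) :=
    contMDiff_coe contMDiff_id
  refine ⟨fun p hp => ?_, fun p hp => ?_⟩
  · exact ((contDiffAt_angle u v hp).contMDiffAt.comp p (hs p)).contMDiffWithinAt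
  · have hp' : 0 < inner ℝ u (p : Eucl (n + 1)) := hp
    rw [laplacian_eq_mapLap, mapLap_comp _ (hs p) (contDiffAt_two (contDiffAt_angle u v hp))]
    have h1 := tangentPart_mapLap_coe p
    rw [tangentPart, sub_eq_zero] at h1
    -- The Laplacian of the inclusion is a multiple of p, and the angle is constant along rays, so
    -- the first-order term drops out.
    have h2 : fderiv ℝ (angle u v) (p : Eucl (n + 1)) (p : Eucl (n + 1)) = 0 := by
      rw [fderiv_angle u v hp, mul_comm, sub_self, zero_div]
    rw [h1, map_smul, h2, smul_zero, add_zero]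
    have hP := sum_inner_mul_inner_of_orthonormal (sphere_inner_self p)
      (inner_fderiv_chartIncl_frame p) (fun i => inner_chartIncl_fderiv p _)
    change ∑ i, deriv₂ (angle u v) (p : Eucl (n + 1))
      (fderiv ℝ (chartIncl p) (center p) (frame (roundMetric n) p i))
      (fderiv ℝ (chartIncl p) (center p) (frame (roundMetric n) p i)) = 0
    generalize hτ : (fun i => fderiv ℝ (chartIncl p) (center p) (frame (roundMetric n) p i)) = τ
    have hτ' : ∀ i, fderiv ℝ (chartIncl p) (center p) (frame (roundMetric n) p i) = τ i :=
      fun i => congrFun hτ i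
    simp only [hτ'] at hP ⊢
    simp only [deriv₂_angle u v hp', ← Finset.sum_div, ← Finset.mul_sum]
    generalize (p : Eucl (n + 1)) = P at *
    have e1 := hP u u
    have e2 := hP v v
    have e3 := hP u v
    -- With U = ⟨u,P⟩ and W = ⟨v,P⟩, Parseval turns the right side into (U² - W²)(-UW) + UW((|v|² -
    -- W²) - (|u|² - U²)), which is zero as |u| = |v|.
    have e4 : ∑ i, (inner ℝ v (τ i) * inner ℝ u P - inner ℝ v P * inner ℝ u (τ i)) *
        (inner ℝ u P * inner ℝ u (τ i) + inner ℝ v P * inner ℝ v (τ i)) =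
        (inner ℝ u P ^ 2 - inner ℝ v P ^ 2) * ∑ i, inner ℝ u (τ i) * inner ℝ (τ i) v
        + (inner ℝ u P * inner ℝ v P) * (∑ i, inner ℝ v (τ i) * inner ℝ (τ i) v
          - ∑ i, inner ℝ u (τ i) * inner ℝ (τ i) u) := by
      rw [← Finset.sum_sub_distrib, Finset.mul_sum, Finset.mul_sum, ← Finset.sum_add_distrib]
      refine Finset.sum_congr rfl fun i _ => ?_
      rw [real_inner_comm v (τ i), real_inner_comm u (τ i)]
      ring
    rw [e4, e1, e2, e3, huv, h, real_inner_comm v P, real_inner_comm u P]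
    ring

end RoundLaplacian

/-! ### Harmonic morphisms to the sphere are horizontally conformal harmonic maps -/

section HarmonicMorphism

open Filter Topology

/-- A symmetric bilinear form that vanishes on orthogonal vectors is a multiple of the inner
product. -/
theorem bilin_eq_of_orthogonal {k : ℕ} {p : Eucl k} (hp : inner ℝ p p = 1)
    (Q : LinearMap.BilinForm ℝ (Eucl k)) (hQ : ∀ a b, Q a b = Q b a) (hQp : ∀ a, Q p a = 0)
    (h : ∀ a b, inner ℝ p a = 0 → inner ℝ p b = 0 → inner ℝ a b = 0 → Q a b = 0)
    {d : Eucl k} (hd : d ≠ 0) (hpd : inner ℝ p d = 0) (a b : Eucl k) :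
    Q a b = Q d d / ‖d‖ ^ 2 * (inner ℝ a b - inner ℝ p a * inner ℝ p b) := by
  have hd' : ‖d‖ ≠ 0 := norm_ne_zero_iff.2 hd
  have h1 : ∀ a, inner ℝ p a = 0 → Q a a = Q d d / ‖d‖ ^ 2 * inner ℝ a a := fun a ha => by
    -- Sum and difference of two vectors of equal length are orthogonal; Q on this pair is ‖d‖²
    -- Q(a,a) - ‖a‖² Q(d,d).
    have h2 := h (‖d‖ • a + ‖a‖ • d) (‖d‖ • a - ‖a‖ • d)
      (by simp [inner_add_right, inner_smul_right, ha, hpd])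
      (by simp [inner_sub_right, inner_smul_right, ha, hpd])
      (by
        simp only [inner_add_left, inner_sub_right, inner_smul_left, inner_smul_right,
          real_inner_self_eq_norm_sq, conj_trivial, real_inner_comm a d]
        ring)
    simp only [map_add, map_sub, map_smul, LinearMap.add_apply, LinearMap.smul_apply,
      smul_eq_mul, hQ d a] at h2
    rw [real_inner_self_eq_norm_sq]
    field_simp
    linarith
  have h2 : ∀ a b, inner ℝ p a = 0 → inner ℝ p b = 0 →
      Q a b = Q d d / ‖d‖ ^ 2 * inner ℝ a b := fun a b ha hb => by
    have e := h1 (a + b) (by simp [inner_add_right, ha, hb])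
    simp only [map_add, LinearMap.add_apply, inner_add_left, inner_add_right, h1 a ha, h1 b hb,
      hQ b a, real_inner_comm a b] at e
    linarith
  have e1 : ∀ a, inner ℝ p (a - inner ℝ p a • p) = 0 := fun a => by
    rw [inner_sub_right, inner_smul_right, hp, mul_one, sub_self]
  have e := h2 _ _ (e1 a) (e1 b)
  simp only [map_sub, map_smul, LinearMap.sub_apply, LinearMap.smul_apply, hQp, hQ _ p,
    smul_zero, sub_zero, inner_sub_left, inner_sub_right, inner_smul_left, inner_smul_right, hp,
    conj_trivial, real_inner_comm p a] at e
  rw [e]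
  ring

/-- The bilinear form `(a, b) ↦ ∑ i, ⟨a, d i⟩ ⟨b, d i⟩`. -/
def gramForm {k : ℕ} {ι : Type*} [Fintype ι] (d : ι → Eucl k) : LinearMap.BilinForm ℝ (Eucl k) :=
  LinearMap.mk₂ ℝ (fun a b => ∑ i, inner ℝ a (d i) * inner ℝ b (d i))
    (fun a b c => by simp only [inner_add_left, add_mul, Finset.sum_add_distrib])
    (fun r a b => by
      simp only [inner_smul_left, conj_trivial, mul_assoc, Finset.mul_sum, smul_eq_mul])
    (fun a b c => by simp only [inner_add_left, mul_add, Finset.sum_add_distrib])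
    (fun r a b => by
      simp only [inner_smul_left, conj_trivial, mul_left_comm, Finset.mul_sum, smul_eq_mul])

theorem gramForm_apply {k : ℕ} {ι : Type*} [Fintype ι] (d : ι → Eucl k) (a b : Eucl k) :
    gramForm d a b = ∑ i, inner ℝ a (d i) * inner ℝ b (d i) := rfl

variable {m n : ℕ} {M : Type*} [TopologicalSpace M] [ChartedSpace (Eucl m) M]
  [IsManifold (𝓡 m) ∞ M] {F : Type*} [NormedAddCommGroup F] [NormedSpace ℝ F]
  {g : SmoothMetric m M} {φ : M → Sph n}

/-- The images `dφ(e_i)` of the orthonormal frame at `x`. -/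
def mapFrame (g : SmoothMetric m M) (φ : M → Sph n) (x : M) (i : Fin m) : Eucl (n + 1) :=
  mapDeriv φ x (frame g x i) (center x)

theorem IsHarmonicMorphism.sum_deriv₂_angle (hφ : IsHarmonicMorphism g (roundMetric n) φ) (x : M)
    {u v : Eucl (n + 1)} (h : inner ℝ u u = inner ℝ v v) (huv : inner ℝ u v = 0)
    (hu : 0 < inner ℝ u (φ x : Eucl (n + 1))) :
    ∑ i, deriv₂ (angle u v) (φ x : Eucl (n + 1)) (mapFrame g φ x i) (mapFrame g φ x i) +
      fderiv ℝ (angle u v) (φ x : Eucl (n + 1))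
        (mapLap g (fun z => (φ z : Eucl (n + 1))) x) = 0 := by
  have ho : IsOpen {q : Sph n | 0 < inner ℝ u (q : Eucl (n + 1))} :=
    isOpen_lt continuous_const (by fun_prop)
  have h1 := (hφ.2 _ _ ho (isHarmonicFunctionOn_angle h huv)).2 x hu
  rw [laplacian_eq_mapLap] at h1
  rw [← h1]
  exact (mapLap_comp g (f := fun z => (φ z : Eucl (n + 1))) (h := angle u v)
    (contMDiff_coe hφ.1 x) (contDiffAt_two (contDiffAt_angle u v hu))).symm

/-- Test with u = |v| φ(x). At φ(x) the second derivatives of this angle along tangent vectors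
vanish, and its first derivative is a nonzero multiple of ⟨v,·⟩. -/
theorem IsHarmonicMorphism.inner_mapLap_eq_zero (hφ : IsHarmonicMorphism g (roundMetric n) φ)
    (x : M) {v : Eucl (n + 1)} (hv : inner ℝ (φ x : Eucl (n + 1)) v = 0) :
    inner ℝ v (mapLap g (fun z => (φ z : Eucl (n + 1))) x) = 0 := by
  by_cases h0 : v = 0
  · simp [h0]
  have h0' : 0 < ‖v‖ := norm_pos_iff.2 h0
  have hP := sphere_inner_self (φ x)
  have hd : ∀ i, inner ℝ (φ x : Eucl (n + 1)) (mapFrame g φ x i) = 0 := fun i =>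
    inner_map_mapDeriv hφ.1 x _
  have hr : inner ℝ (‖v‖ • (φ x : Eucl (n + 1))) (φ x : Eucl (n + 1)) = ‖v‖ := by
    rw [inner_smul_left, hP, conj_trivial, mul_one]
  have hv' : inner ℝ v (φ x : Eucl (n + 1)) = 0 := by rw [real_inner_comm, hv]
  have hpos : 0 < inner ℝ (‖v‖ • (φ x : Eucl (n + 1))) (φ x : Eucl (n + 1)) := by rwa [hr]
  have h1 := hφ.sum_deriv₂_angle x (u := ‖v‖ • (φ x : Eucl (n + 1))) (v := v)
    (by rw [inner_smul_right, hr, real_inner_self_eq_norm_sq, pow_two])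
    (by rw [inner_smul_left, hv, mul_zero]) hpos
  simp only [deriv₂_angle _ _ hpos, fderiv_angle _ _ hpos, hr, hv'] at h1
  simp only [inner_smul_left, hd] at h1
  simp only [mul_zero, zero_mul, add_zero, zero_div, Finset.sum_const_zero, zero_add,
    sub_zero] at h1
  rw [div_eq_zero_iff] at h1
  rcases h1 with h1 | h1
  · exact (mul_eq_zero.1 h1).resolve_right h0'.ne'
  · nlinarith

/-- Tilt the first axis: u = k(φ(x) + w). The first-order term is a multiple of ⟨v,Δφ⟩ = 0, and the
second-order sum is -2/k times the Gram form of w and v. -/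
theorem IsHarmonicMorphism.gramForm_eq_zero (hφ : IsHarmonicMorphism g (roundMetric n) φ)
    (x : M) {w v : Eucl (n + 1)} (hw : inner ℝ (φ x : Eucl (n + 1)) w = 0)
    (hv : inner ℝ (φ x : Eucl (n + 1)) v = 0) (hwv : inner ℝ w v = 0) :
    gramForm (mapFrame g φ x) w v = 0 := by
  by_cases h0 : v = 0
  · simp [h0]
  have h0' : 0 < ‖v‖ := norm_pos_iff.2 h0
  have hP := sphere_inner_self (φ x)
  have hd : ∀ i, inner ℝ (φ x : Eucl (n + 1)) (mapFrame g φ x i) = 0 := fun i =>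
    inner_map_mapDeriv hφ.1 x _
  have hs : 0 < 1 + ‖w‖ ^ 2 := by positivity
  -- This k makes |k(φ(x) + w)| = |v|, as harmonicity of the angle requires.
  obtain ⟨k, hk, hk2⟩ : ∃ k : ℝ, 0 < k ∧ k ^ 2 * (1 + ‖w‖ ^ 2) = ‖v‖ ^ 2 := by
    refine ⟨‖v‖ / √(1 + ‖w‖ ^ 2), by positivity, ?_⟩
    rw [div_pow, Real.sq_sqrt hs.le]
    field_simp
  have hw' : inner ℝ w (φ x : Eucl (n + 1)) = 0 := by rw [real_inner_comm, hw]
  have hv' : inner ℝ v (φ x : Eucl (n + 1)) = 0 := by rw [real_inner_comm, hv]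
  have hr : inner ℝ (k • ((φ x : Eucl (n + 1)) + w)) (φ x : Eucl (n + 1)) = k := by
    rw [inner_smul_left, inner_add_left, hP, hw', conj_trivial, add_zero, mul_one]
  have hpos : 0 < inner ℝ (k • ((φ x : Eucl (n + 1)) + w)) (φ x : Eucl (n + 1)) := by rwa [hr]
  have h1 := hφ.sum_deriv₂_angle x (u := k • ((φ x : Eucl (n + 1)) + w)) (v := v)
    (by
      rw [inner_smul_left, inner_smul_right, inner_add_left, inner_add_right, inner_add_right, hP,
        hw, hw', real_inner_self_eq_norm_sq, real_inner_self_eq_norm_sq, ← hk2, conj_trivial]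
      ring)
    (by rw [inner_smul_left, inner_add_left, hv, hwv, add_zero, mul_zero]) hpos
  simp only [deriv₂_angle _ _ hpos, fderiv_angle _ _ hpos, hr, hv',
    hφ.inner_mapLap_eq_zero x hv] at h1
  simp only [inner_smul_left, inner_add_left, hd, conj_trivial] at h1
  have h2 : ∀ i, -2 * ((inner ℝ v (mapFrame g φ x i) * k
      - 0 * (k * (0 + inner ℝ w (mapFrame g φ x i)))) *
      (k * (k * (0 + inner ℝ w (mapFrame g φ x i))) + 0 * inner ℝ v (mapFrame g φ x i))) /
      (k ^ 2 + 0 ^ 2) ^ 2 =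
      -2 / k * (inner ℝ w (mapFrame g φ x i) * inner ℝ v (mapFrame g φ x i)) := fun i => by
    field_simp
    ring
  simp only [h2, ← Finset.mul_sum] at h1
  simp only [zero_mul, sub_zero, zero_div, add_zero] at h1
  exact (mul_eq_zero.1 h1).resolve_left (div_ne_zero (by norm_num) hk.ne')

theorem IsHarmonicMorphism.isHarmonicMap (hφ : IsHarmonicMorphism g (roundMetric n) φ) :
    IsHarmonicMap g φ := by
  refine ⟨hφ.1, fun x => ?_⟩
  rw [tension_eq g hφ.1]
  have h0 : inner ℝ (φ x : Eucl (n + 1)) (tangentPart (φ x : Eucl (n + 1))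
      (mapLap g (fun z => (φ z : Eucl (n + 1))) x)) = 0 := by
    rw [tangentPart, inner_sub_right, inner_smul_right, sphere_inner_self, mul_one, sub_self]
  have h1 := hφ.inner_mapLap_eq_zero x h0
  rw [real_inner_comm, ← inner_tangentPart h0] at h1
  exact inner_self_eq_zero.1 h1

/-- `φ` is horizontally conformal at `x` with dilation `l`. -/
def IsDilation (g : SmoothMetric m M) (φ : M → Sph n) (x : M) (l : ℝ) : Prop :=
  0 < l ∧ ∀ a b : Eucl (n + 1), gramForm (mapFrame g φ x) a b =
    l * (inner ℝ a b - inner ℝ (φ x : Eucl (n + 1)) a * inner ℝ (φ x : Eucl (n + 1)) b)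

theorem IsHarmonicMorphism.exists_isDilation (hn : 1 ≤ n)
    (hφ : IsHarmonicMorphism g (roundMetric n) φ) (x : M)
    (hsub : Function.Surjective (mfderiv (𝓡 m) (𝓡 n) φ x)) : ∃ l, IsDilation g φ x l := by
  obtain ⟨i, hi⟩ := exists_mapDeriv_frame_ne_zero g hn hφ.1 x hsub
  have hd : ∀ i, inner ℝ (φ x : Eucl (n + 1)) (mapFrame g φ x i) = 0 := fun i =>
    inner_map_mapDeriv hφ.1 x _
  have hpos : 0 < ‖mapFrame g φ x i‖ := norm_pos_iff.2 hi
  refine ⟨gramForm (mapFrame g φ x) (mapFrame g φ x i) (mapFrame g φ x i) /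
    ‖mapFrame g φ x i‖ ^ 2, div_pos ?_ (by positivity), fun a b => ?_⟩
  · rw [gramForm_apply]
    refine Finset.sum_pos' (fun j _ => mul_self_nonneg _) ⟨i, Finset.mem_univ i, ?_⟩
    rw [real_inner_self_eq_norm_sq]
    positivity
  · refine bilin_eq_of_orthogonal (sphere_inner_self (φ x)) (gramForm (mapFrame g φ x))
      (fun a b => ?_) (fun a => ?_) (fun a b ha hb hab => hφ.gramForm_eq_zero x ha hb hab) hi
      (hd i) a b
    · simp only [gramForm_apply, mul_comm]
    · simp [gramForm_apply, hd]

theorem inner_self_eq_sum {k : ℕ} (a : Eucl k) : inner ℝ a a = ∑ j, a j * a j := by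
  rw [PiLp.inner_apply]
  exact Finset.sum_congr rfl fun j _ => rfl

theorem inner_single_left' {k : ℕ} (j : Fin k) (a : Eucl k) :
    inner ℝ (EuclideanSpace.single j (1 : ℝ)) a = a j := by
  simp [EuclideanSpace.inner_single_left]

/-- In coordinates the dilation identity reads Σᵢ dᵢdᵢᵀ = l(1 - PPᵀ) for dᵢ = dφ(eᵢ); contract it
with the Hessian of h. -/
theorem IsDilation.sum_deriv₂ {x : M} {l : ℝ} (hl : IsDilation g φ x l)
    {h : Eucl (n + 1) → F} (hh : ContDiffAt ℝ 2 h (φ x : Eucl (n + 1))) :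
    ∑ i, deriv₂ h (φ x : Eucl (n + 1)) (mapFrame g φ x i) (mapFrame g φ x i) =
      l • (lap h (φ x : Eucl (n + 1)) -
        deriv₂ h (φ x : Eucl (n + 1)) (φ x : Eucl (n + 1)) (φ x : Eucl (n + 1))) := by
  set P : Eucl (n + 1) := (φ x : Eucl (n + 1)) with hPdef
  set b : Fin (n + 1) → Eucl (n + 1) := fun j => EuclideanSpace.single j (1 : ℝ)
  have hexp : ∀ w : Eucl (n + 1), deriv₂ h P w w =
      ∑ j, ∑ k, (w j * w k) • deriv₂ h P (b j) (b k) := fun w => by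
    simp only [deriv₂_eq hh]
    conv_lhs => rw [← sum_smul_single w]
    simp only [map_sum, map_smul, sum_apply, smul_apply, Finset.smul_sum, mul_smul]
    rw [Finset.sum_comm]
    exact Finset.sum_congr rfl fun j _ => Finset.sum_congr rfl fun k _ => smul_comm _ _ _
  have hQ : ∀ j k, ∑ i, mapFrame g φ x i j * mapFrame g φ x i k =
      l * ((if j = k then 1 else 0) - P j * P k) := fun j k => by
    have := hl.2 (b j) (b k)
    rw [gramForm_apply] at this
    simp only [b, inner_single_left'] at this
    rw [this, real_inner_comm, inner_single_left', real_inner_comm, inner_single_left']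
    simp [hPdef]
  calc ∑ i, deriv₂ h P (mapFrame g φ x i) (mapFrame g φ x i)
      = ∑ j, ∑ k, (∑ i, mapFrame g φ x i j * mapFrame g φ x i k) • deriv₂ h P (b j) (b k) := by
        simp only [hexp (mapFrame g φ x _), Finset.sum_smul]
        rw [Finset.sum_comm]
        exact Finset.sum_congr rfl fun j _ => Finset.sum_comm
    _ = l • (lap h P - deriv₂ h P P P) := by
        simp only [hQ, hexp P, lap_eq, mul_smul, sub_smul, ← Finset.smul_sum,
          Finset.sum_sub_distrib]
        simp [b]

theorem IsDilation.sum_inner_smul {x : M} {l : ℝ} (hl : IsDilation g φ x l) (w : Eucl (n + 1)) :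
    ∑ i, inner ℝ (mapFrame g φ x i) w • mapFrame g φ x i =
      l • tangentPart (φ x : Eucl (n + 1)) w := by
  refine ext_inner_right ℝ fun a => ?_
  have := hl.2 w a
  rw [gramForm_apply] at this
  rw [tangentPart, sum_inner, inner_smul_left, inner_sub_left, inner_smul_left, conj_trivial,
    conj_trivial, ← this]
  refine Finset.sum_congr rfl fun i _ => ?_
  rw [inner_smul_left, conj_trivial, real_inner_comm w, real_inner_comm a]

/-- Take the trace of l(1 - PPᵀ) on a space of dimension n + 1. -/
theorem IsDilation.energy_eq {x : M} {l : ℝ} (hl : IsDilation g φ x l) :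
    energy g φ x = n * l := by
  have h1 : energy g φ x = ∑ j : Fin (n + 1), gramForm (mapFrame g φ x)
      (EuclideanSpace.single j (1 : ℝ)) (EuclideanSpace.single j (1 : ℝ)) := by
    simp only [gramForm_apply, inner_single_left']
    rw [Finset.sum_comm]
    refine Finset.sum_congr rfl fun i _ => ?_
    exact inner_self_eq_sum (mapFrame g φ x i)
  have h2 : ∑ j : Fin (n + 1), (φ x : Eucl (n + 1)) j * (φ x : Eucl (n + 1)) j = 1 :=
    (inner_self_eq_sum _).symm.trans (sphere_inner_self (φ x))
  rw [h1]
  simp only [hl.2, real_inner_comm (EuclideanSpace.single _ (1 : ℝ)) (φ x : Eucl (n + 1)),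
    ← Finset.mul_sum, Finset.sum_sub_distrib]
  simp only [inner_single_left', h2]
  simp
  ring

/-- The Laplacian of a function factoring through a horizontally conformal harmonic map. -/
theorem IsHarmonicMap.mapLap_comp {x : M} {l : ℝ} (hφ : IsHarmonicMap g φ)
    (hl : IsDilation g φ x l) {h : Eucl (n + 1) → F}
    (hh : ContDiffAt ℝ 2 h (φ x : Eucl (n + 1))) :
    mapLap g (fun z => h (φ z : Eucl (n + 1))) x =
      l • (lap h (φ x : Eucl (n + 1)) -
        deriv₂ h (φ x : Eucl (n + 1)) (φ x : Eucl (n + 1)) (φ x : Eucl (n + 1))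
        - (n : ℝ) • fderiv ℝ h (φ x : Eucl (n + 1)) (φ x : Eucl (n + 1))) := by
  have h1 := SphereRigidity.mapLap_comp g (f := fun z => (φ z : Eucl (n + 1))) (h := h)
    (contMDiff_coe hφ.1 x) hh
  have h2 := hl.sum_deriv₂ hh
  -- Here Δφ = -n l φ supplies the term -n ∂ᵣh, completing the spherical Laplacian Δh - ∂ᵣ²h - n
  -- ∂ᵣh.
  rw [hφ.mapLap_eq, hl.energy_eq] at h1
  refine h1.trans ?_
  rw [smul_sub _ (_ - _), ← h2, map_smul, smul_smul, mul_comm l, neg_smul, ← sub_eq_add_neg]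
  rfl

theorem exists_eq_smul_map (hsurj : Function.Surjective φ) {q : Eucl (n + 1)} (hq : q ≠ 0) :
    ∃ x, q = ‖q‖ • (φ x : Eucl (n + 1)) := by
  have hq' := norm_ne_zero_iff.2 hq
  obtain ⟨x, hx⟩ := hsurj ⟨‖q‖⁻¹ • q, by simp [norm_smul, hq']⟩
  refine ⟨x, ?_⟩
  rw [hx, smul_smul, mul_inv_cancel₀ hq', one_smul]

/-- A function constant on the fibres of `φ` descends to a function on punctured Euclidean space
that is homogeneous of degree zero; it is smooth if `φ` is a horizontally conformal
submersion. -/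
theorem exists_descent (hφ : ContMDiff (𝓡 m) (𝓡 n) ∞ φ) (hsurj : Function.Surjective φ)
    (hl : ∀ x, ∃ l, IsDilation g φ x l) {V : M → F}
    (hV : ContMDiff (𝓡 m) 𝓘(ℝ, F) ∞ V) (hproj : ∀ x x', φ x = φ x' → V x = V x') :
    ∃ W : Eucl (n + 1) → F, IsSmoothOffZero W ∧ IsHomogeneous 0 W ∧
      ∀ x, V x = W (φ x : Eucl (n + 1)) := by
  classical
  let W : Eucl (n + 1) → F := fun q =>
    if h : ∃ x, ‖q‖ • (φ x : Eucl (n + 1)) = q then V h.choose else 0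
  have hW : ∀ (x : M) (r : ℝ), 0 < r → W (r • (φ x : Eucl (n + 1))) = V x := by
    intro x r hr
    have hnorm : ‖r • (φ x : Eucl (n + 1))‖ = r := by
      rw [norm_smul, sphere_norm, mul_one, Real.norm_of_nonneg hr.le]
    have h : ∃ z, ‖r • (φ x : Eucl (n + 1))‖ • (φ z : Eucl (n + 1)) = r • (φ x : Eucl (n + 1)) :=
      ⟨x, by rw [hnorm]⟩
    simp only [W]
    rw [dif_pos h]
    apply hproj
    have h1 : r • (φ h.choose : Eucl (n + 1)) = r • (φ x : Eucl (n + 1)) := by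
      generalize h.choose = z, h.choose_spec = hz at *
      rwa [hnorm] at hz
    exact Subtype.ext (smul_right_injective _ hr.ne' h1)
  refine ⟨W, fun q₀ hq₀ => ?_, fun q hq₀ r hr => ?_, fun x => ?_⟩
  · obtain ⟨x, hx⟩ := exists_eq_smul_map hsurj hq₀
    obtain ⟨l, hl⟩ := hl x
    have hl0 := hl.1
    set ρ := ‖q₀‖
    have hρ : 0 < ρ := norm_pos_iff.2 hq₀
    let Φ : Eucl m → Eucl (n + 1) := inChart x fun z => (φ z : Eucl (n + 1))
    have hΦ : ContDiffAt ℝ ∞ Φ (center x) := contDiffAt_inChart (contMDiff_coe hφ x)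
    let P : Eucl (n + 1) := φ x
    -- A multiple of the adjoint of dφ: since dφ dφ* is l times the tangential projection, B is, up
    -- to the factor ρ⁻¹, a right inverse of dφ on tangent vectors.
    let B : Eucl (n + 1) →L[ℝ] Eucl m :=
      (ρ * l)⁻¹ • ∑ i, (innerSL ℝ (mapFrame g φ x i)).smulRight (frame g x i)
    have hB : ∀ w, fderiv ℝ Φ (center x) (B w) = ρ⁻¹ • (w - inner ℝ P w • P) := fun w => by
      have h1 : fderiv ℝ Φ (center x) (B w) =
          (ρ * l)⁻¹ • ∑ i, inner ℝ (mapFrame g φ x i) w • mapFrame g φ x i := by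
        simp [B, map_sum]
        rfl
      rw [h1, hl.sum_inner_smul, tangentPart, smul_smul]
      congr 1
      field_simp
    -- Ψ maps 0 to q₀ with derivative the identity: B covers the tangential directions, the scalar
    -- factor the radial one. Its local inverse θ gives a smooth local section of φ over a cone,
    -- along which W is V in the chart.
    let Ψ : Eucl (n + 1) → Eucl (n + 1) := fun w => (ρ + inner ℝ P w) • Φ (center x + B w)
    have hc0 : center x + B 0 = center x := by simp
    have hΦB : ContDiffAt ℝ ∞ (fun w => Φ (center x + B w)) 0 :=
      ContDiffAt.comp (g := Φ) (f := fun w => center x + B w) 0 (by rw [hc0]; exact hΦ)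
        (contDiffAt_const.add B.contDiff.contDiffAt)
    have hsc : ContDiffAt ℝ ∞ (fun w : Eucl (n + 1) => ρ + inner ℝ P w) 0 :=
      contDiffAt_const.add (innerSL ℝ P).contDiff.contDiffAt
    have hΨ : ContDiffAt ℝ ∞ Ψ 0 := hsc.smul hΦB
    have hΨ0 : Ψ 0 = q₀ := by
      simp only [Ψ, map_zero, add_zero, inner_zero_right, Φ, inChart_center]
      exact hx.symm
    have hΨ' : HasFDerivAt Ψ
        ((ContinuousLinearEquiv.refl ℝ (Eucl (n + 1)) : Eucl (n + 1) ≃L[ℝ] Eucl (n + 1)) :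
          Eucl (n + 1) →L[ℝ] Eucl (n + 1)) 0 := by
      have e1 : HasFDerivAt (fun w : Eucl (n + 1) => ρ + inner ℝ P w) (innerSL ℝ P) 0 :=
        (innerSL ℝ P).hasFDerivAt.const_add ρ
      have e2 : HasFDerivAt (fun w => Φ (center x + B w))
          ((fderiv ℝ Φ (center x)).comp B) 0 := by
        refine HasFDerivAt.comp (g := Φ) (f := fun w => center x + B w) 0 ?_
          (B.hasFDerivAt.const_add _)
        rw [hc0]
        exact (hΦ.differentiableAt (by simp)).hasFDerivAt
      refine (e1.fun_smul e2).congr_fderiv ?_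
      ext1 w
      simp only [add_apply, smul_apply, ContinuousLinearMap.smulRight_apply,
        ContinuousLinearMap.comp_apply, hB, map_zero, add_zero, inner_zero_right, Φ,
        inChart_center, innerSL_apply_apply, smul_smul, mul_inv_cancel₀ hρ.ne', one_smul,
        ContinuousLinearEquiv.coe_coe, ContinuousLinearEquiv.coe_refl', id_eq]
      simp [P]
    have hstr := hΨ.hasStrictFDerivAt' hΨ' (by simp)
    let θ := hΨ.localInverse hΨ' (by simp)
    have hθ : ContDiffAt ℝ ∞ θ q₀ := by
      have := hΨ.to_localInverse hΨ' (by simp)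
      rwa [hΨ0] at this
    have hθ0 : θ q₀ = 0 := by
      have := hstr.localInverse_apply_image
      rwa [hΨ0] at this
    have hright : ∀ᶠ q in 𝓝 q₀, Ψ (θ q) = q := by
      have := hstr.eventually_right_inverse
      rwa [hΨ0] at this
    have hpos : ∀ᶠ q in 𝓝 q₀, 0 < ρ + inner ℝ P (θ q) := by
      have hc : ContinuousAt (fun q => ρ + inner ℝ P (θ q)) q₀ :=
        continuousAt_const.add (continuousAt_const.inner hθ.continuousAt)
      exact hc.eventually_const_lt (by simpa [hθ0] using hρ)
    have hfin : ContDiffAt ℝ ∞ (fun q => inChart x V (center x + B (θ q))) q₀ := by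
      refine ContDiffAt.comp (g := inChart x V) (f := fun q => center x + B (θ q)) q₀ ?_
        (contDiffAt_const.add (B.contDiff.contDiffAt.comp q₀ hθ))
      rw [hθ0, hc0]
      exact contDiffAt_inChart (hV x)
    refine hfin.congr_of_eventuallyEq ?_
    filter_upwards [hright, hpos] with q h1 h2
    conv_lhs => rw [← h1]
    exact hW _ _ h2
  · obtain ⟨x, hx⟩ := exists_eq_smul_map hsurj hq₀
    have hn := norm_pos_iff.2 hq₀
    have h1 := hW x _ hn
    rw [← hx] at h1
    rw [zpow_zero, one_smul, h1]
    conv_lhs => rw [hx, smul_smul]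
    exact hW x _ (mul_pos hr hn)
  · simpa using (hW x 1 one_pos).symm

end HarmonicMorphism

/-! ### Projectable vector fields along harmonic morphisms -/

section Rigidity

open Filter Topology

variable {m n : ℕ} {M : Type*} [TopologicalSpace M] [ChartedSpace (Eucl m) M]
  [IsManifold (𝓡 m) ∞ M] {F : Type*} [NormedAddCommGroup F] [NormedSpace ℝ F]
  {g : SmoothMetric m M} {φ : M → Sph n} {V : M → Eucl (n + 1)}

theorem IsHomogeneous.lap {N : ℕ} {k : ℤ} {f : Eucl N → F} (hk : IsHomogeneous k f) :
    IsHomogeneous (k - 1 - 1) (lap f) := fun x hx r hr => by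
  rw [lap_eq, lap_eq, Finset.smul_sum]
  exact Finset.sum_congr rfl fun i _ => ((hk.fderiv_apply _).fderiv_apply _) x hx r hr

theorem toEuclideanLin_apply_apply {k : ℕ} (X : Matrix (Fin k) (Fin k) ℝ) (q : Eucl k)
    (i : Fin k) : Matrix.toEuclideanLin X q i = ∑ j, X i j * q j := rfl

theorem toEuclideanLin_single {k : ℕ} (X : Matrix (Fin k) (Fin k) ℝ) (i j : Fin k) :
    Matrix.toEuclideanLin X (EuclideanSpace.single i (1 : ℝ)) j = X j i := by
  simp [Matrix.toLpLin_apply]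

theorem inner_toEuclideanLin_single {k : ℕ} (X : Matrix (Fin k) (Fin k) ℝ) (i j : Fin k) :
    inner ℝ (EuclideanSpace.single j (1 : ℝ)) (Matrix.toEuclideanLin X
      (EuclideanSpace.single i (1 : ℝ))) = X j i := by
  rw [inner_single_left', toEuclideanLin_single]

theorem mem_so_of_inner_self_eq_zero {k : ℕ} {X : Matrix (Fin k) (Fin k) ℝ}
    (h : ∀ q : Eucl k, inner ℝ q (Matrix.toEuclideanLin X q) = 0) :
    X ∈ LieAlgebra.Orthogonal.so (Fin k) ℝ := by
  rw [LieAlgebra.Orthogonal.mem_so]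
  ext i j
  have h1 := h (EuclideanSpace.single i (1 : ℝ) + EuclideanSpace.single j (1 : ℝ))
  rw [map_add, inner_add_left, inner_add_right, inner_add_right, h, h,
    inner_toEuclideanLin_single, inner_toEuclideanLin_single] at h1
  rw [Matrix.transpose_apply, Matrix.neg_apply]
  linarith

/-- A projectable vector field satisfying the eigenvalue equation of the first spherical harmonics
is the restriction of a skew-symmetric linear field. -/
theorem exists_so_of_mapLap_eq (hn : 1 ≤ n) (hφ : IsHarmonicMap g φ)
    (hsurj : Function.Surjective φ) (hl : ∀ x, ∃ l, IsDilation g φ x l)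
    (hV : IsVectorFieldAlong m φ V) (hproj : IsProjectable φ V)
    (h : ∀ x, mapLap g V x = -energy g φ x • V x) :
    ∃ X ∈ LieAlgebra.Orthogonal.so (Fin (n + 1)) ℝ,
      ∀ x, V x = Matrix.toEuclideanLin X (φ x : Eucl (n + 1)) := by
  obtain ⟨W, hWs, hW0, hVW⟩ := exists_descent hφ.1 hsurj hl hV.1 hproj
  let W₁ : Eucl (n + 1) → Eucl (n + 1) := fun q => ‖q‖ • W q
  have hW₁s : IsSmoothOffZero W₁ := fun q hq => (contDiffAt_norm ℝ hq).smul (hWs q hq)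
  have hW₁ : IsHomogeneous 1 W₁ := fun q hq r hr => by
    simp only [W₁, hW0 q hq r hr, norm_smul, Real.norm_of_nonneg hr.le, zpow_zero, one_smul,
      zpow_one, smul_smul]
  have hVW₁ : V = fun x => W₁ (φ x : Eucl (n + 1)) := funext fun x => by
    simp only [W₁, sphere_norm, one_smul, hVW x]
  -- In degree one ∂ᵣ²W₁ = 0 and ∂ᵣW₁ = W₁ on the sphere, so ΔV = l(ΔW₁ - n W₁); comparison with ΔV
  -- = -n l V leaves ΔW₁ = 0.
  have hlap₀ : ∀ x, lap W₁ (φ x : Eucl (n + 1)) = 0 := fun x => by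
    obtain ⟨l, hlx⟩ := hl x
    have h1 := h x
    have hp := sphere_ne_zero (φ x)
    rw [hVW₁, hφ.mapLap_comp hlx (hW₁s.two hp), hW₁.deriv₂_self hW₁s hp,
      hW₁.fderiv_self hp ((hW₁s _ hp).differentiableAt (by simp)), hlx.energy_eq] at h1
    simp only [Int.cast_one, sub_self, zero_smul, one_smul, sub_zero, smul_sub, smul_smul,
      neg_smul, mul_comm l] at h1
    rw [sub_eq_neg_self] at h1
    exact (smul_eq_zero.1 h1).resolve_left hlx.1.ne'
  have hlap : ∀ q, q ≠ 0 → lap W₁ q = 0 := fun q hq => by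
    obtain ⟨x, hx⟩ := exists_eq_smul_map hsurj hq
    rw [hx, hW₁.lap _ (sphere_ne_zero (φ x)) _ (norm_pos_iff.2 hq), hlap₀, smul_zero]
  have hcomp : ∀ i : Fin (n + 1), ∃ A : Eucl (n + 1) →L[ℝ] ℝ, ∀ q, q ≠ 0 → W₁ q i = A q := by
    intro i
    let pr : Eucl (n + 1) →L[ℝ] ℝ := EuclideanSpace.proj i
    refine exists_linear_of_lap_eq_zero (f := fun q => pr (W₁ q)) (by omega)
      (fun q hq => pr.contDiff.contDiffAt.comp q (hW₁s q hq)) (fun q hq r hr => ?_)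
      (fun q hq => ?_)
    · simp only [hW₁ q hq r hr, map_smul]
    · have := diffOp_clm_comp pr (hW₁s.two hq)
        (fun i : Fin (n + 1) => EuclideanSpace.single i (1 : ℝ)) 0
      exact this.trans (by rw [← SphereRigidity.lap, hlap q hq, map_zero])
  choose A hA using hcomp
  let X : Matrix (Fin (n + 1)) (Fin (n + 1)) ℝ := fun i j => A i (EuclideanSpace.single j 1)
  have hX : ∀ q, q ≠ 0 → W₁ q = Matrix.toEuclideanLin X q := fun q hq => by
    ext i
    rw [hA i q hq, toEuclideanLin_apply_apply]
    conv_lhs => rw [← sum_smul_single q]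
    simp [X, mul_comm]
  refine ⟨X, mem_so_of_inner_self_eq_zero fun q => ?_, fun x => ?_⟩
  · by_cases hq : q = 0
    · simp [hq]
    obtain ⟨x, hx⟩ := exists_eq_smul_map hsurj hq
    have h1 : inner ℝ (φ x : Eucl (n + 1)) (W₁ (φ x : Eucl (n + 1))) = 0 := by
      have := hV.2 x
      rwa [hVW₁] at this
    rw [hx, map_smul, inner_smul_left, inner_smul_right, ← hX _ (sphere_ne_zero _), h1]
    simp
  · rw [← hX _ (sphere_ne_zero _), hVW₁]

/-! ### Fields along a map and the Jacobi operator -/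

theorem IsVectorFieldAlong.inner_fderiv (hφ : ContMDiff (𝓡 m) (𝓡 n) ∞ φ)
    (hV : IsVectorFieldAlong m φ V) (x : M) (u : Eucl m) :
    inner ℝ (φ x : Eucl (n + 1)) (fderiv ℝ (inChart x V) (center x) u) =
      -inner ℝ (mapDeriv φ x u (center x)) (V x) := by
  have h1 := ((contDiffAt_inChart (contMDiff_coe hφ x)).differentiableAt
    (by simp)).hasFDerivAt.inner ℝ
    ((contDiffAt_inChart (hV.1 x)).differentiableAt (by simp)).hasFDerivAt
  have h2 : (fun y => inner ℝ (inChart (m := m) x (fun z => (φ z : Eucl (n + 1))) y)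
      (inChart (m := m) x V y)) = fun _ => (0 : ℝ) := funext fun y => hV.2 _
  rw [h2] at h1
  have h3 := congrArg (fun A : Eucl m →L[ℝ] ℝ => A u) (h1.unique (hasFDerivAt_const 0 _))
  simp only [ContinuousLinearMap.comp_apply, ContinuousLinearMap.prod_apply,
    fderivInnerCLM_apply, zero_apply, inChart_center] at h3
  exact eq_neg_of_add_eq_zero_left h3

/-- Apply the Laplacian to ⟨φ,V⟩ = 0; the term ⟨Δφ,V⟩ vanishes because Δφ is a multiple of φ. -/
theorem IsVectorFieldAlong.inner_mapLap (hφ : IsHarmonicMap g φ)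
    (hV : IsVectorFieldAlong m φ V) (x : M) :
    inner ℝ (φ x : Eucl (n + 1)) (mapLap g V x) =
      -(2 * ∑ i, inner ℝ (mapFrame g φ x i) (fderiv ℝ (inChart x V) (center x) (frame g x i))) := by
  have h1 := diffOp_inner (contDiffAt_two (contDiffAt_inChart (contMDiff_coe hφ.1 x)))
    (contDiffAt_two (contDiffAt_inChart (hV.1 x))) (frame g x)
    (∑ i, christoffel g x (frame g x i) (frame g x i))
  have h2 : (fun y => inner ℝ (inChart (m := m) x (fun z => (φ z : Eucl (n + 1))) y)
      (inChart (m := m) x V y)) = fun _ => (0 : ℝ) := funext fun y => hV.2 _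
  rw [h2, diffOp_const, inChart_center, inChart_center] at h1
  change 0 = inner ℝ (mapLap g (fun z => (φ z : Eucl (n + 1))) x) (V x)
    + 2 * ∑ i, inner ℝ (mapFrame g φ x i) (fderiv ℝ (inChart x V) (center x) (frame g x i))
    + inner ℝ (φ x : Eucl (n + 1)) (mapLap g V x) at h1
  rw [hφ.mapLap_eq, inner_smul_left, hV.2] at h1
  linarith

/-- The Jacobi operator along a horizontally conformal harmonic map. -/
theorem jacobi_eq (hφ : IsHarmonicMap g φ) {x : M} {l : ℝ} (hl : IsDilation g φ x l)
    (hV : IsVectorFieldAlong m φ V) :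
    jacobi g φ V x =
      -tangentPart (φ x : Eucl (n + 1)) (mapLap g V x) - energy g φ x • V x := by
  have hd : ∀ i, inner ℝ (φ x : Eucl (n + 1)) (mapFrame g φ x i) = 0 := fun i =>
    inner_map_mapDeriv hφ.1 x _
  have hVx := tangentPart_of_inner_eq_zero (hV.2 x)
  -- The last term comes from differentiating the projection in the inner covariant derivative. Its
  -- trace is l V, which cancels the -l V in the curvature trace `h3`.
  have h1 : ∀ i, secondNabla g φ V x (frame g x i) (frame g x i) =
      tangentPart (φ x : Eucl (n + 1)) (deriv₂ (inChart x V) (center x) (frame g x i) (frame g x i)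
        - fderiv ℝ (inChart x V) (center x) (christoffel g x (frame g x i) (frame g x i)))
        + inner ℝ (mapFrame g φ x i) (V x) • mapFrame g φ x i := fun i => by
    have hG : DifferentiableAt ℝ (fun y => fderiv ℝ (inChart x V) y (frame g x i)) (center x) :=
      (differentiableAt_fderiv (contDiffAt_two (contDiffAt_inChart (hV.1 x)))).clm_apply
        (differentiableAt_const _)
    have h2 := tangentPart_fderiv_tangentPart
      ((contDiffAt_inChart (contMDiff_coe hφ.1 x)).differentiableAt (by simp)) hG
      (by rw [inChart_center]; exact sphere_inner_self _)
      (u := frame g x i) (by rw [inChart_center]; exact hd i)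
    rw [inChart_center, hV.inner_fderiv hφ.1] at h2
    rw [tangentPart_sub, secondNabla, pullbackNabla, inChart_center]
    refine (congrArg₂ _ h2 rfl).trans ?_
    rw [neg_smul, sub_neg_eq_add, add_sub_right_comm]
    rfl
  have h2 : ∑ i, secondNabla g φ V x (frame g x i) (frame g x i) =
      tangentPart (φ x : Eucl (n + 1)) (mapLap g V x) + l • V x := by
    simp only [h1, Finset.sum_add_distrib]
    rw [← tangentPart_sum, Finset.sum_sub_distrib, ← map_sum, hl.sum_inner_smul, hVx]
    rfl
  have h3 : ∑ i, sphereCurvature (φ x) (mapDeriv φ x (frame g x i) (center x)) (V x)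
      (mapDeriv φ x (frame g x i) (center x)) = energy g φ x • V x - l • V x := by
    have h4 : ∀ i, sphereCurvature (φ x) (mapDeriv φ x (frame g x i) (center x)) (V x)
        (mapDeriv φ x (frame g x i) (center x)) =
        inner ℝ (mapFrame g φ x i) (mapFrame g φ x i) • V x
          - inner ℝ (mapFrame g φ x i) (V x) • mapFrame g φ x i := fun i => by
      refine (sphereCurvature_eq (φ x) (hd i) (hV.2 x) (hd i)).trans ?_
      rw [real_inner_comm _ (V x)]
    simp only [h4, Finset.sum_sub_distrib, ← Finset.sum_smul]
    rw [hl.sum_inner_smul, hVx]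
    rfl
  rw [jacobi, h2, h3]
  abel

/-- The trace condition kills the normal component of ΔV, and the Jacobi equation determines the
tangential one. -/
theorem MemK.mapLap_eq (hφ : IsHarmonicMap g φ) (hl : ∀ x, ∃ l, IsDilation g φ x l)
    (hV : MemK g φ V) (x : M) : mapLap g V x = -energy g φ x • V x := by
  obtain ⟨l, hlx⟩ := hl x
  have h1 := hV.1.2 x
  rw [jacobi_eq hφ hlx hV.1.1] at h1
  have h2 := hV.1.1.inner_mapLap hφ x
  have h3 : ∑ i, inner ℝ (mapFrame g φ x i)
      (fderiv ℝ (inChart x V) (center x) (frame g x i)) = 0 := by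
    rw [← hV.2 x]
    refine Finset.sum_congr rfl fun i _ => ?_
    rw [pullbackNabla, inChart_center, real_inner_comm _ (mapDeriv φ x _ _),
      inner_tangentPart (inner_map_mapDeriv hφ.1 x (frame g x i)), real_inner_comm]
    rfl
  rw [h3, mul_zero, neg_zero] at h2
  rw [tangentPart_of_inner_eq_zero h2] at h1
  rw [neg_smul, eq_neg_iff_add_eq_zero, ← neg_eq_zero, ← h1]
  abel

/-! ### Harmonic variations -/

theorem expVariation_eq (hV : IsVectorFieldAlong m φ V) (t : ℝ) (x : M) :
    (expVariation φ V t x : Eucl (n + 1)) =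
      Real.cos (t * ‖V x‖) • (φ x : Eucl (n + 1))
        + Real.sin (t * ‖V x‖) • (‖V x‖⁻¹ • V x) := by
  rw [expVariation, sphereExp_eq _ (by rw [inner_smul_right, hV.2, mul_zero]), norm_smul,
    Real.norm_eq_abs]
  by_cases hv : V x = 0
  · simp [hv]
  have hv' := norm_ne_zero_iff.2 hv
  rcases lt_trichotomy t 0 with ht | rfl | ht
  · rw [abs_of_neg ht, neg_mul, Real.cos_neg, Real.sin_neg, smul_smul, smul_smul]
    have ht' := ht.ne
    congr 2
    field_simp
  · simp
  · rw [abs_of_pos ht, smul_smul, smul_smul]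
    congr 2
    field_simp

/-- The norm of a harmonic variation is harmonic where it does not vanish. -/
theorem IsHarmonicVariation.diffOp_norm (hφ : IsHarmonicMap g φ) (hV : IsHarmonicVariation g φ V)
    {x : M} (hx : V x ≠ 0) :
    diffOp (frame g x) (∑ i, christoffel g x (frame g x i) (frame g x i))
      (fun y => ‖inChart x V y‖) (center x) = 0 := by
  set e := frame g x
  set c := ∑ i, christoffel g x (frame g x i) (frame g x i)
  set y₀ : Eucl m := center x
  let Φ : Eucl m → Eucl (n + 1) := inChart x fun z => (φ z : Eucl (n + 1))
  let v : Eucl m → Eucl (n + 1) := inChart x V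
  let ρ : Eucl m → ℝ := fun y => ‖v y‖
  let N : Eucl m → Eucl (n + 1) := fun y => (ρ y)⁻¹ • v y
  have hv0 : v y₀ = V x := inChart_center x V
  have hΦ0 : Φ y₀ = φ x := inChart_center x _
  have hvy : v y₀ ≠ 0 := by rwa [hv0]
  have hΦ : ContDiffAt ℝ ∞ Φ y₀ := contDiffAt_inChart (contMDiff_coe hφ.1 x)
  have hv : ContDiffAt ℝ ∞ v y₀ := contDiffAt_inChart (hV.1.1 x)
  have hρ : ContDiffAt ℝ ∞ ρ y₀ := hv.norm ℝ hvy
  have hρ0 : 0 < ρ y₀ := norm_pos_iff.2 hvy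
  have hN : ContDiffAt ℝ ∞ N y₀ := (hρ.inv hρ0.ne').smul hv
  -- At this time x reaches the antipode of φ(x): sin(tρ) vanishes, cos(tρ) is stationary, and Δ
  -- sin(tρ) reduces to -t Δρ.
  let t : ℝ := Real.pi / ρ y₀
  have ht : t * ρ y₀ = Real.pi := div_mul_cancel₀ _ hρ0.ne'
  have hcos : ContDiff ℝ ∞ fun s => Real.cos (t * s) := by fun_prop
  have hsin : ContDiff ℝ ∞ fun s => Real.sin (t * s) := by fun_prop
  have dlin : ∀ s, HasDerivAt (fun s => t * s) t s := fun s => by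
    simpa using (hasDerivAt_id s).const_mul t
  have dcos : ∀ s, HasDerivAt (fun s => Real.cos (t * s)) (-Real.sin (t * s) * t) s := fun s =>
    (dlin s).cos
  have dsin : ∀ s, HasDerivAt (fun s => Real.sin (t * s)) (Real.cos (t * s) * t) s := fun s =>
    (dlin s).sin
  have hc : ContDiffAt ℝ 2 (fun y => Real.cos (t * ρ y)) y₀ :=
    contDiffAt_two (hcos.contDiffAt.comp y₀ hρ)
  have hs : ContDiffAt ℝ 2 (fun y => Real.sin (t * ρ y)) y₀ :=
    contDiffAt_two (hsin.contDiffAt.comp y₀ hρ)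
  have hcd : ∀ u, fderiv ℝ (fun y => Real.cos (t * ρ y)) y₀ u = 0 := fun u => by
    have := (dcos (ρ y₀)).comp_hasFDerivAt y₀ (hρ.differentiableAt (by simp)).hasFDerivAt
    change HasFDerivAt (fun y => Real.cos (t * ρ y)) _ y₀ at this
    rw [this.fderiv, ht]
    simp
  have hsL : diffOp e c (fun y => Real.sin (t * ρ y)) y₀ = -t * diffOp e c ρ y₀ := by
    have h1 := diffOp_comp_real (h := fun s => Real.sin (t * s))
      (contDiffAt_two hsin.contDiffAt) (contDiffAt_two hρ) e c
    have h2 : deriv (fun s => Real.sin (t * s)) = fun s => Real.cos (t * s) * t :=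
      funext fun s => (dsin s).deriv
    have h3 : deriv (fun s => Real.cos (t * s) * t) (ρ y₀) = 0 := by
      rw [((dcos (ρ y₀)).mul_const t).deriv, ht]
      simp
    rw [h2, h3] at h1
    simpa [ht] using h1
  have hNN : ∀ u, inner ℝ (fderiv ℝ N y₀ u) (N y₀) = 0 := fun u => by
    have hd := (hN.differentiableAt (by simp)).hasFDerivAt
    have h1 := hd.inner ℝ hd
    have h2 : (fun y => inner ℝ (N y) (N y)) =ᶠ[𝓝 y₀] fun _ => (1 : ℝ) := by
      filter_upwards [hv.continuousAt.eventually_ne hvy] with y hy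
      have : ‖v y‖ ≠ 0 := norm_ne_zero_iff.2 hy
      simp only [N, ρ, inner_smul_left, inner_smul_right, real_inner_self_eq_norm_sq, conj_trivial]
      field_simp
    have h3 := congrArg (fun A : Eucl m →L[ℝ] ℝ => A u)
      ((h1.congr_of_eventuallyEq h2.symm).unique (hasFDerivAt_const 1 _))
    simp only [ContinuousLinearMap.comp_apply, ContinuousLinearMap.prod_apply,
      fderivInnerCLM_apply, zero_apply] at h3
    rw [real_inner_comm (N y₀)] at h3 ⊢
    linarith
  have hN1 : inner ℝ (N y₀) (N y₀) = 1 := by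
    simp only [N, inner_smul_left, inner_smul_right, real_inner_self_eq_norm_sq, conj_trivial]
    change (ρ y₀)⁻¹ * ((ρ y₀)⁻¹ * ρ y₀ ^ 2) = 1
    field_simp
  have hΦN : inner ℝ (φ x : Eucl (n + 1)) (N y₀) = 0 := by
    simp only [N, inner_smul_right, hv0, hV.1.2, mul_zero]
  have hvar : inChart (m := m) x (fun z => (expVariation φ V t z : Eucl (n + 1))) =
      fun y => Real.cos (t * ρ y) • Φ y + Real.sin (t * ρ y) • N y :=
    funext fun y => expVariation_eq hV.1 t _
  have hharm := (hV.2 t).mapLap_eq x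
  have hexp0 : (expVariation φ V t x : Eucl (n + 1)) = -(φ x : Eucl (n + 1)) := by
    rw [expVariation_eq hV.1, ← hv0]
    change Real.cos (t * ρ y₀) • (φ x : Eucl (n + 1)) + Real.sin (t * ρ y₀) • _ = _
    rw [ht]
    simp
  rw [hexp0, mapLap, hvar, diffOp_add (f := fun y => Real.cos (t * ρ y) • Φ y)
    (g := fun y => Real.sin (t * ρ y) • N y)
    (hc.smul (contDiffAt_two hΦ)) (hs.smul (contDiffAt_two hN)),
    diffOp_smul hc (contDiffAt_two hΦ), diffOp_smul hs (contDiffAt_two hN)] at hharm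
  have hΦL : diffOp e c Φ y₀ = -energy g φ x • (φ x : Eucl (n + 1)) := hφ.mapLap_eq x
  -- Paired with the unit vector N, which is orthogonal to φ and to its own derivatives, the
  -- harmonic map equation retains only -t Δρ = 0.
  have key := congrArg (fun w => inner ℝ w (N y₀)) hharm
  change inner ℝ (diffOp e c (fun y => Real.cos (t * ρ y)) y₀ • Φ y₀
    + (2 : ℝ) • ∑ i, fderiv ℝ (fun y => Real.cos (t * ρ y)) y₀ (e i) • fderiv ℝ Φ y₀ (e i)
    + Real.cos (t * ρ y₀) • diffOp e c Φ y₀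
    + (diffOp e c (fun y => Real.sin (t * ρ y)) y₀ • N y₀
    + (2 : ℝ) • ∑ i, fderiv ℝ (fun y => Real.sin (t * ρ y)) y₀ (e i) • fderiv ℝ N y₀ (e i)
    + Real.sin (t * ρ y₀) • diffOp e c N y₀)) (N y₀) =
    inner ℝ (-energy g (expVariation φ V t) x • -(φ x : Eucl (n + 1))) (N y₀) at key
  simp only [hcd, zero_smul, Finset.sum_const_zero, smul_zero, hΦL, hΦ0, ht, Real.sin_pi,
    inner_add_left, inner_smul_left, inner_neg_left, sum_inner, hΦN, hN1, hNN, hsL,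
    mul_zero, add_zero, zero_add, conj_trivial, mul_one, neg_zero] at key
  have htpos : t ≠ 0 := (div_pos Real.pi_pos hρ0).ne'
  exact (mul_eq_zero.1 key).resolve_left (neg_ne_zero.2 htpos)

/-- The square of |V| is used because it is smooth across zeros. At a zero of V its Laplacian is
2|dV|²; elsewhere |V| is harmonic and the Laplacian is 2|d|V||². -/
theorem IsHarmonicVariation.mapLap_inner_self_nonneg (hφ : IsHarmonicMap g φ)
    (hV : IsHarmonicVariation g φ V) (x : M) :
    0 ≤ mapLap g (fun z => inner ℝ (V z) (V z)) x := by
  have hv := contDiffAt_inChart (hV.1.1 x)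
  by_cases hx : V x = 0
  · have h1 := diffOp_inner (contDiffAt_two hv) (contDiffAt_two hv) (frame g x)
      (∑ i, christoffel g x (frame g x i) (frame g x i))
    rw [inChart_center, hx, inner_zero_left, inner_zero_right, zero_add, add_zero] at h1
    refine le_of_le_of_eq ?_ h1.symm
    exact mul_nonneg zero_le_two (Finset.sum_nonneg fun i _ => real_inner_self_nonneg)
  · have hρ : ContDiffAt ℝ 2 (fun y => ‖inChart x V y‖) (center x : Eucl m) :=
      contDiffAt_two (hv.norm ℝ (by rwa [inChart_center]))
    have h1 := diffOp_inner hρ hρ (frame g x) (∑ i, christoffel g x (frame g x i) (frame g x i))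
    rw [hV.diffOp_norm hφ hx, inner_zero_left, inner_zero_right, zero_add, add_zero] at h1
    have h2 : inChart (m := m) x (fun z => inner ℝ (V z) (V z)) =
        fun y => inner ℝ ‖inChart x V y‖ ‖inChart x V y‖ := funext fun y => by
      simp only [inChart, real_inner_self_eq_norm_sq, norm_norm]
    rw [mapLap, h2, h1]
    exact mul_nonneg zero_le_two (Finset.sum_nonneg fun i _ => real_inner_self_nonneg)

/-- A projectable harmonic variation has constant length. -/
theorem IsHarmonicVariation.norm_eq (hn : 1 ≤ n) (hφ : IsHarmonicMap g φ)
    (hsurj : Function.Surjective φ) (hl : ∀ x, ∃ l, IsDilation g φ x l)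
    (hV : IsHarmonicVariation g φ V) (hproj : IsProjectable φ V) (x x' : M) :
    ‖V x‖ = ‖V x'‖ := by
  obtain ⟨W, hWs, hW0, hVW⟩ := exists_descent hφ.1 hsurj hl hV.1.1 hproj
  -- In degree zero the radial terms vanish, so Δ|V|² = l Δu with l > 0, and u is subharmonic.
  let u : Eucl (n + 1) → ℝ := fun q => inner ℝ (W q) (W q)
  have hu : IsSmoothOffZero u := fun q hq => (hWs q hq).inner ℝ (hWs q hq)
  have hu0 : IsHomogeneous 0 u := fun q hq r hr => by
    simp [u, hW0 q hq r hr]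
  have hlap₀ : ∀ x, 0 ≤ lap u (φ x : Eucl (n + 1)) := fun x => by
    obtain ⟨l, hlx⟩ := hl x
    have h1 := hV.mapLap_inner_self_nonneg hφ x
    have hp := sphere_ne_zero (φ x)
    have h2 : (fun z => inner ℝ (V z) (V z)) = fun z => u (φ z : Eucl (n + 1)) :=
      funext fun z => by simp only [u, hVW z]
    rw [h2, hφ.mapLap_comp hlx (hu.two hp), hu0.deriv₂_self hu hp,
      hu0.fderiv_self hp ((hu _ hp).differentiableAt (by simp))] at h1
    simp only [Int.cast_zero, zero_mul, mul_zero, sub_zero, smul_eq_mul] at h1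
    exact nonneg_of_mul_nonneg_right h1 hlx.1
  have hlap : ∀ q, q ≠ 0 → 0 ≤ lap u q := fun q hq => by
    obtain ⟨x, hx⟩ := exists_eq_smul_map hsurj hq
    rw [hx, hu0.lap _ (sphere_ne_zero (φ x)) _ (norm_pos_iff.2 hq)]
    exact mul_nonneg (by positivity) (hlap₀ x)
  have h := eq_of_lap_nonneg (by omega) hu hu0 hlap (sphere_ne_zero (φ x)) (sphere_ne_zero (φ x'))
  simp only [u, ← hVW, real_inner_self_eq_norm_sq] at h
  exact (pow_left_inj₀ (norm_nonneg _) (norm_nonneg _) two_ne_zero).1 h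

/-- With |V| = c the map exp(tV) is a combination of φ and V with constant coefficients. At tc = π/2
it is V/c, so V is an eigenfield with the energy density of that map; at tc = π/4, comparing the
components along φ and V identifies this density with that of φ. -/
theorem IsHarmonicVariation.mapLap_eq (hφ : IsHarmonicMap g φ) (hV : IsHarmonicVariation g φ V)
    {c : ℝ} (hc : 0 < c) (hVc : ∀ x, ‖V x‖ = c) (x : M) :
    mapLap g V x = -energy g φ x • V x := by
  have hΦ := contDiffAt_two (contDiffAt_inChart (contMDiff_coe hφ.1 x))
  have hv := contDiffAt_two (contDiffAt_inChart (hV.1.1 x))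
  have hVV : inner ℝ (V x) (V x) = c ^ 2 := by rw [real_inner_self_eq_norm_sq, hVc]
  have hΦV := hV.1.2 x
  have hΦV' : inner ℝ (V x) (φ x : Eucl (n + 1)) = 0 := by rw [real_inner_comm, hΦV]
  have key : ∀ t : ℝ, Real.cos (t * c) • mapLap g (fun z => (φ z : Eucl (n + 1))) x +
      (Real.sin (t * c) * c⁻¹) • mapLap g V x = -energy g (expVariation φ V t) x •
        (Real.cos (t * c) • (φ x : Eucl (n + 1)) + (Real.sin (t * c) * c⁻¹) • V x) := fun t => by
    have h1 : ∀ z, (expVariation φ V t z : Eucl (n + 1)) =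
        Real.cos (t * c) • (φ z : Eucl (n + 1)) + (Real.sin (t * c) * c⁻¹) • V z := fun z => by
      rw [expVariation_eq hV.1, hVc, smul_smul]
    rw [← h1, ← (hV.2 t).mapLap_eq x]
    simp only [h1]
    rw [mapLap, mapLap, mapLap, ← diffOp_const_smul _ hΦ, ← diffOp_const_smul _ hv,
      ← diffOp_add (f := fun y => Real.cos (t * c) • inChart x (fun z => (φ z : Eucl (n + 1))) y)
        (g := fun y => (Real.sin (t * c) * c⁻¹) • inChart x V y)
        (hΦ.const_smul _) (hv.const_smul _)]
    rfl
  have k1 := key (Real.pi / 2 / c)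
  rw [div_mul_cancel₀ _ hc.ne', Real.cos_pi_div_two, Real.sin_pi_div_two, zero_smul, zero_smul,
    zero_add, zero_add, one_mul, smul_comm] at k1
  replace k1 := smul_right_injective _ (inv_ne_zero hc.ne') k1
  have k2 := key (Real.pi / 4 / c)
  rw [div_mul_cancel₀ _ hc.ne', Real.cos_pi_div_four, Real.sin_pi_div_four, hφ.mapLap_eq x] at k2
  rw [k1] at k2 ⊢
  have k3 := congrArg (fun w => inner ℝ (φ x : Eucl (n + 1)) w) k2
  have k4 := congrArg (fun w => inner ℝ (V x) w) k2
  simp only [inner_add_right, inner_smul_right, hΦV, hΦV', hVV, sphere_inner_self, mul_zero,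
    mul_one, add_zero, zero_add] at k3 k4
  have hs : √2 ≠ 0 := by positivity
  generalize energy g (expVariation φ V (Real.pi / 2 / c)) x = e₁ at *
  generalize energy g (expVariation φ V (Real.pi / 4 / c)) x = e₂ at *
  have h1 : energy g φ x = e₂ := by
    field_simp at k3
    linarith
  have h2 : e₁ = e₂ := by
    field_simp at k4
    linarith
  rw [h2, ← h1]

/-! ### One-parameter groups of rotations -/

/-- The rotation `cos (t c) + (sin (t c) / c) X`, which is `exp (t X)` if `X² = -c²`. -/
def rotationMatrix {k : ℕ} (X : Matrix (Fin k) (Fin k) ℝ) (c t : ℝ) : Matrix (Fin k) (Fin k) ℝ :=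
  Real.cos (t * c) • 1 + (Real.sin (t * c) * c⁻¹) • X

theorem rotationMatrix_mul_transpose {k : ℕ} {X : Matrix (Fin k) (Fin k) ℝ} {c : ℝ} (hc : c ≠ 0)
    (hX : Matrix.transpose X = -X) (hX2 : X * X = -(c ^ 2 • (1 : Matrix (Fin k) (Fin k) ℝ)))
    (t : ℝ) : rotationMatrix X c t * (rotationMatrix X c t).transpose = 1 := by
  rw [rotationMatrix, Matrix.transpose_add, Matrix.transpose_smul, Matrix.transpose_smul,
    Matrix.transpose_one, hX]
  simp only [add_mul, mul_add, Matrix.smul_mul, Matrix.mul_smul, Matrix.one_mul, Matrix.mul_one,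
    mul_neg, hX2, smul_neg]
  match_scalars
  · field_simp
    linarith [Real.cos_sq_add_sin_sq (t * c)]
  · ring

theorem rotationMatrix_add {k : ℕ} {X : Matrix (Fin k) (Fin k) ℝ} {c : ℝ} (hc : c ≠ 0)
    (hX2 : X * X = -(c ^ 2 • (1 : Matrix (Fin k) (Fin k) ℝ))) (s t : ℝ) :
    rotationMatrix X c (s + t) = rotationMatrix X c s * rotationMatrix X c t := by
  simp only [rotationMatrix, add_mul, Real.cos_add, Real.sin_add, mul_add, Matrix.smul_mul,
    Matrix.mul_smul, Matrix.one_mul, Matrix.mul_one, hX2, smul_neg]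
  match_scalars
  · field_simp
    ring
  · ring

/-- The one-parameter group generated by a skew-symmetric matrix `X` with `X² = -c²`. -/
def rotationGroup {k : ℕ} {X : Matrix (Fin k) (Fin k) ℝ} {c : ℝ} (hc : c ≠ 0)
    (hX : Matrix.transpose X = -X) (hX2 : X * X = -(c ^ 2 • (1 : Matrix (Fin k) (Fin k) ℝ))) :
    Multiplicative ℝ →ₜ* Matrix.orthogonalGroup (Fin k) ℝ where
  toFun t := ⟨rotationMatrix X c t.toAdd, (Matrix.mem_orthogonalGroup_iff _ _).2
    (rotationMatrix_mul_transpose hc hX hX2 _)⟩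
  map_one' := Subtype.ext (by simp [rotationMatrix])
  map_mul' s t := Subtype.ext (rotationMatrix_add hc hX2 s.toAdd t.toAdd)
  continuous_toFun := by
    refine Continuous.subtype_mk ?_ _
    have h : Continuous fun t : Multiplicative ℝ => t.toAdd := continuous_toAdd
    unfold rotationMatrix
    fun_prop

/-- Polarising the norm identity gives XᵀX = c², and Xᵀ = -X. -/
theorem mul_self_of_norm_eq {k : ℕ} {X : Matrix (Fin k) (Fin k) ℝ} {c : ℝ}
    (hX : Matrix.transpose X = -X)
    (h : ∀ q : Eucl k, ‖Matrix.toEuclideanLin X q‖ = c * ‖q‖) :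
    X * X = -(c ^ 2 • (1 : Matrix (Fin k) (Fin k) ℝ)) := by
  have h1 : ∀ q : Eucl k, inner ℝ (Matrix.toEuclideanLin X q) (Matrix.toEuclideanLin X q) =
      c ^ 2 * inner ℝ q q := fun q => by
    rw [real_inner_self_eq_norm_sq, real_inner_self_eq_norm_sq, h, mul_pow]
  have h2 : ∀ p q : Eucl k, inner ℝ (Matrix.toEuclideanLin X p) (Matrix.toEuclideanLin X q) =
      c ^ 2 * inner ℝ p q := fun p q => by
    have := h1 (p + q)
    rw [map_add, inner_add_left, inner_add_right, inner_add_right, inner_add_left,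
      inner_add_right, inner_add_right, h1, h1, real_inner_comm p q,
      real_inner_comm (Matrix.toEuclideanLin X p) (Matrix.toEuclideanLin X q)] at this
    linarith
  have h3 : X.transpose * X = c ^ 2 • (1 : Matrix (Fin k) (Fin k) ℝ) := by
    ext i j
    have := h2 (EuclideanSpace.single i (1 : ℝ)) (EuclideanSpace.single j (1 : ℝ))
    rw [inner_single_left', PiLp.inner_apply] at this
    simp only [toEuclideanLin_single] at this
    rw [Matrix.mul_apply, Matrix.smul_apply, Matrix.one_apply, smul_eq_mul]
    refine Eq.trans ?_ (this.trans ?_)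
    · exact Finset.sum_congr rfl fun l _ => mul_comm _ _
    · simp
  rw [← h3, hX, neg_mul, neg_neg]

end Rigidity

end SphereRigidity

end

/-! ### The rigidity theorem -/

theorem theorem3p4 {m n : ℕ} (hn : 1 ≤ n) {M : Type*} [TopologicalSpace M]
    [ChartedSpace (EuclideanSpace ℝ (Fin m)) M] [IsManifold (𝓡 m) ∞ M]
    (g : SmoothMetric m M) (φ : M → Sph n)
    (hφ : IsHarmonicMorphism g (roundMetric n) φ)
    (hsurj : Function.Surjective φ)
    (hsub : ∀ x, Function.Surjective (mfderiv (𝓡 m) (𝓡 n) φ x)) :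
    IsInfinitesimallyRigid g φ ∧ (Odd n → IsLocallyRigid g φ) := by
  have hh := hφ.isHarmonicMap
  have hl : ∀ x, ∃ l, IsDilation g φ x l := fun x => hφ.exists_isDilation hn x (hsub x)
  refine ⟨⟨hh, fun V hp hV => ?_⟩, fun _ => ⟨hh, fun V hp hV => ?_⟩⟩
  · exact exists_so_of_mapLap_eq hn hh hsurj hl hV.1.1 hp (hV.mapLap_eq hh hl)
  -- The zero field is generated by the trivial subgroup; it is separated because the rotation group
  -- divides by c.
  by_cases h0 : ∀ x, V x = 0
  · refine ⟨1, fun t x => ?_⟩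
    rw [expVariation_eq hV.1, h0]
    simp
  push Not at h0
  obtain ⟨x₀, hx₀⟩ := h0
  have hc := norm_pos_iff.2 hx₀
  have hVc : ∀ x, ‖V x‖ = ‖V x₀‖ := fun x => hV.norm_eq hn hh hsurj hl hp x x₀
  obtain ⟨X, hX, hVX⟩ := exists_so_of_mapLap_eq hn hh hsurj hl hV.1 hp
    (hV.mapLap_eq hh hc hVc)
  rw [LieAlgebra.Orthogonal.mem_so] at hX
  -- Every q is ‖q‖ φ(x) for some x, so constancy of |V| = |Xφ| makes X a multiple of an isometry.
  have hX2 := mul_self_of_norm_eq (c := ‖V x₀‖) hX fun q => by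
    by_cases hq : q = 0
    · simp [hq]
    obtain ⟨x, hx⟩ := exists_eq_smul_map hsurj hq
    conv_lhs => rw [hx, map_smul, ← hVX, norm_smul, hVc, norm_norm, mul_comm]
  refine ⟨rotationGroup hc.ne' hX hX2, fun t x => ?_⟩
  rw [expVariation_eq hV.1, hVc]
  conv_lhs => rw [smul_smul, hVX x]
  change _ = Matrix.toEuclideanLin (rotationMatrix X ‖V x₀‖ t) (φ x : Eucl (n + 1))
  simp [rotationMatrix]
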